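/- Let $n\ge 3$ and $1\le k\le n-3$. A $k$-dissection of a convex $n$-gon with vertices $0,1,\dots,n-1$ (in cyclic order) is a set of $k$ pairwise non-crossing diagonals (equivalently, a partition of the $n$-gon into $k+1$ polygons by $k$ non-crossing diagonals). Let $G(n,k)$ be the set of $k$-dissections of the $n$-gon, and let the cyclic group $Z_n$ act on $G(n,k)$ by the rotations of the $n$-gon, generated by $v\mapsto v+1 \pmod n$. For rational $x,y$ define $A^x_y=|G(x,y)|$ if $x,y$ are integers with $x\ge 3$ and $0\le y\le x-3$, put $A^2_0=1$, and put $A^x_y=0$ in all other cases. Let $\varphi$ be Euler's totient function. Then the number $|G(n,k)/Z_n|$ of $k$-dissections of an $n$-gon up to rotation equals $$\frac1n A^n_k+\frac12 A^{n/2+1}_{(k-1)/2}+\sum_{3\le d\mid n}\frac{\varphi(d)}{d}A^{n/d+1}_{k/d-1}+\sum_{2\le d\le n/3}\frac{\varphi(d)(n+k-d)}{dn}A^{n/d}_{k/d-1}+\sum_{\substack{2\le d\mid n,\ r\ge 3\\ n_1+\cdots+n_r=n/d\\ k_1+\cdots+k_r+|\{i:\,n_i\ge 2\}|=k/d}}\frac{\varphi(d)}{dr}\prod_{i=1}^r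 A^{n_i+1}_{k_i},$$ where $d$ ranges over integers, and the last sum is over all integers $d\ge 2$ dividing $n$, all integers $r\ge 3$, and all $r$-tuples of integers $n_i\ge 1$ and $k_i\ge 0$ satisfying the two displayed equations. -/

import Mathlib

open scoped BigOperators Nat

noncomputable section

namespace PolygonDissection

/-- The vertices of the `n`-gon are `0, …, n - 1`; the rotation `finRotate n` sends `v` to `v + 1`
modulo `n`. A side of the `n`-gon joins a vertex to the next one. -/
def IsSide {n : ℕ} (e : Sym2 (Fin n)) : Prop :=
  ∃ v : Fin n, e = s(v, finRotate n v)

/-- A diagonal joins two distinct vertices and is not a side. -/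
def IsDiagonal {n : ℕ} (e : Sym2 (Fin n)) : Prop :=
  ¬ e.IsDiag ∧ ¬ IsSide e

/-- Two chords cross (in their interiors) iff their endpoints strictly interlace. -/
def Crosses {n : ℕ} (e f : Sym2 (Fin n)) : Prop :=
  ∃ a c b d : Fin n, a < c ∧ c < b ∧ b < d ∧
    ((e = s(a, b) ∧ f = s(c, d)) ∨ (e = s(c, d) ∧ f = s(a, b)))

/-- A `k`-dissection of the `n`-gon, given by its set of `k` pairwise non-crossing diagonals. -/
def IsDissection (n k : ℕ) (D : Finset (Sym2 (Fin n))) : Prop :=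
  D.card = k ∧ (∀ e ∈ D, IsDiagonal e) ∧ ∀ e ∈ D, ∀ f ∈ D, ¬ Crosses e f

/-- The set `G(n,k)` of `k`-dissections of the `n`-gon. -/
def G (n k : ℕ) : Type :=
  {D : Finset (Sym2 (Fin n)) // IsDissection n k D}

/-- The numbers `A^n_k`: the number of `k`-dissections of an `n`-gon for integers `n ≥ 3` and
`0 ≤ k ≤ n - 3`, with `A^2_0 = 1`, and `0` for all other (possibly fractional or negative)
arguments. -/
def A (x y : ℚ) : ℚ :=
  open scoped Classical in
  if x = 2 ∧ y = 0 then 1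
  else if x.isInt ∧ y.isInt ∧ 3 ≤ x ∧ 0 ≤ y ∧ y ≤ x - 3 then
    (Nat.card (G x.num.toNat y.num.toNat) : ℚ)
  else 0

/-- The cyclic group `Z_n`, generated by the rotation. -/
abbrev Z (n : ℕ) : Subgroup (Equiv.Perm (Fin n)) :=
  Subgroup.zpowers (finRotate n)

/-- The image of a set of chords under a permutation of the vertices. -/
def mapChords {n : ℕ} (g : Equiv.Perm (Fin n)) (D : Finset (Sym2 (Fin n))) :
    Finset (Sym2 (Fin n)) :=
  D.image (Sym2.map g)

theorem mem_mapChords {n : ℕ} {g : Equiv.Perm (Fin n)} {D : Finset (Sym2 (Fin n))}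
    {e : Sym2 (Fin n)} : e ∈ mapChords g D ↔ ∃ f ∈ D, Sym2.map g f = e := by
  simp [mapChords]

theorem crosses_rotate {n : ℕ} {e f : Sym2 (Fin n)} (h : Crosses e f) :
    Crosses (Sym2.map (finRotate n) e) (Sym2.map (finRotate n) f) := by
  obtain ⟨a, c, b, d, hac, hcb, hbd, h⟩ := h
  cases n with
  | zero => exact a.elim0
  | succ m =>
    have key : ∀ x y : Fin (m + 1), x < y →
        ((finRotate (m + 1) x : Fin (m + 1)) : ℕ) = x + 1 := by
      intro x y hxy
      have hx : (x : ℕ) < m := by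
        have h1 := Fin.lt_def.1 hxy
        have h2 := y.isLt
        omega
      exact coe_finRotate_of_ne_last (by
        intro hl
        rw [hl] at hx
        simp at hx)
    have ha := key a c hac
    have hc := key c b hcb
    have hb := key b d hbd
    by_cases hd : d = Fin.last m
    · have hd0 : finRotate (m + 1) d = 0 := by rw [hd]; exact finRotate_last
      refine ⟨finRotate _ d, finRotate _ a, finRotate _ c, finRotate _ b, ?_, ?_, ?_, ?_⟩
      · rw [Fin.lt_def, hd0, ha]; simp
      · rw [Fin.lt_def, ha, hc]; have := Fin.lt_def.1 hac; omega
      · rw [Fin.lt_def, hc, hb]; have := Fin.lt_def.1 hcb; omega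
      · rcases h with ⟨rfl, rfl⟩ | ⟨rfl, rfl⟩
        · right; exact ⟨rfl, Sym2.eq_swap⟩
        · left; exact ⟨Sym2.eq_swap, rfl⟩
    · have hd' := coe_finRotate_of_ne_last hd
      refine ⟨finRotate _ a, finRotate _ c, finRotate _ b, finRotate _ d, ?_, ?_, ?_, ?_⟩
      · rw [Fin.lt_def, ha, hc]; have := Fin.lt_def.1 hac; omega
      · rw [Fin.lt_def, hc, hb]; have := Fin.lt_def.1 hcb; omega
      · rw [Fin.lt_def, hb, hd']; have := Fin.lt_def.1 hbd; omega
      · rcases h with ⟨rfl, rfl⟩ | ⟨rfl, rfl⟩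
        · left; exact ⟨rfl, rfl⟩
        · right; exact ⟨rfl, rfl⟩

theorem crosses_pow {n : ℕ} (i : ℕ) {e f : Sym2 (Fin n)} (h : Crosses e f) :
    Crosses (Sym2.map (finRotate n ^ i) e) (Sym2.map (finRotate n ^ i) f) := by
  induction i with
  | zero => simpa using h
  | succ i ih =>
    have := crosses_rotate ih
    rw [Sym2.map_map, Sym2.map_map] at this
    rw [pow_succ']
    exact this

theorem crosses_of_mem {n : ℕ} {g : Equiv.Perm (Fin n)} (hg : g ∈ Z n) {e f : Sym2 (Fin n)}
    (h : Crosses e f) : Crosses (Sym2.map g e) (Sym2.map g f) := by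
  have hg' : g ∈ Submonoid.powers (finRotate n) := mem_powers_iff_mem_zpowers.2 hg
  obtain ⟨i, rfl⟩ := hg'
  exact crosses_pow i h

theorem isSide_of_mem {n : ℕ} {g : Equiv.Perm (Fin n)} (hg : g ∈ Z n) {e : Sym2 (Fin n)}
    (h : IsSide e) : IsSide (Sym2.map g e) := by
  obtain ⟨v, rfl⟩ := h
  obtain ⟨i, rfl⟩ := hg
  refine ⟨(finRotate n ^ i) v, ?_⟩
  have hc : (finRotate n ^ i) (finRotate n v) = finRotate n ((finRotate n ^ i) v) := by
    rw [← Equiv.Perm.mul_apply, ← Equiv.Perm.mul_apply, (Commute.refl (finRotate n)).zpow_left i]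
  change s((finRotate n ^ i) v, (finRotate n ^ i) (finRotate n v)) = _
  rw [hc]

theorem map_inv_map {n : ℕ} (g : Equiv.Perm (Fin n)) (e : Sym2 (Fin n)) :
    Sym2.map (g⁻¹ : Equiv.Perm (Fin n)) (Sym2.map g e) = e := by
  rw [Sym2.map_map]
  have : ((g⁻¹ : Equiv.Perm (Fin n)) : Fin n → Fin n) ∘ g = id := by
    funext x; simp
  rw [this, Sym2.map_id, id]

theorem isDiagonal_of_mem {n : ℕ} {g : Equiv.Perm (Fin n)} (hg : g ∈ Z n) {e : Sym2 (Fin n)}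
    (h : IsDiagonal e) : IsDiagonal (Sym2.map g e) := by
  refine ⟨?_, fun hs => h.2 ?_⟩
  · rw [Sym2.isDiag_map g.injective]; exact h.1
  · have := isSide_of_mem (inv_mem hg) hs
    rwa [map_inv_map] at this

theorem isDissection_mapChords {n k : ℕ} {g : Equiv.Perm (Fin n)} (hg : g ∈ Z n)
    {D : Finset (Sym2 (Fin n))} (h : IsDissection n k D) : IsDissection n k (mapChords g D) := by
  refine ⟨?_, ?_, ?_⟩
  · rw [mapChords, Finset.card_image_of_injective _ (Sym2.map.injective g.injective)]; exact h.1
  · intro e he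
    obtain ⟨e', he', rfl⟩ := mem_mapChords.1 he
    exact isDiagonal_of_mem hg (h.2.1 e' he')
  · intro e he f hf hx
    obtain ⟨e', he', rfl⟩ := mem_mapChords.1 he
    obtain ⟨f', hf', rfl⟩ := mem_mapChords.1 hf
    have := crosses_of_mem (inv_mem hg) hx
    rw [map_inv_map, map_inv_map] at this
    exact h.2.2 e' he' f' hf' this

/-- The action of the cyclic group `Z_n` on the `k`-dissections of the `n`-gon by rotations. -/
instance (n k : ℕ) : MulAction (Z n) (G n k) where
  smul g D := ⟨mapChords g.1 D.1, isDissection_mapChords g.2 D.2⟩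
  one_smul D := by
    apply Subtype.ext
    ext e
    change e ∈ mapChords 1 D.1 ↔ _
    rw [mem_mapChords]
    simp
  mul_smul g h D := by
    apply Subtype.ext
    ext e
    change e ∈ mapChords (g.1 * h.1) D.1 ↔ e ∈ mapChords g.1 (mapChords h.1 D.1)
    simp only [mem_mapChords, Equiv.Perm.coe_mul, exists_exists_and_eq_and, Sym2.map_map]

/-- The set `G(n,k)/Z_n` of cyclic classes of `k`-dissections of the `n`-gon. -/
abbrev CyclicClasses (n k : ℕ) : Type :=
  MulAction.orbitRel.Quotient (Z n) (G n k)

/-- The pairs of `r`-tuples `(n_1, …, n_r)`, `(k_1, …, k_r)` with `n_i ≥ 1`, `k_i ≥ 0`,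
`n_1 + ⋯ + n_r = n / d` and `k_1 + ⋯ + k_r + |{i : n_i ≥ 2}| = k / d` (as rational numbers).
The bounds `n_i ≤ n`, `k_i ≤ k` follow from these equations when `d ≥ 1`. -/
def compositionPairs (n k d r : ℕ) : Finset ((Fin r → ℕ) × (Fin r → ℕ)) :=
  ((Fintype.piFinset fun _ => Finset.Icc 1 n) ×ˢ (Fintype.piFinset fun _ => Finset.Icc 0 k)).filter
    fun p => ((∑ i, p.1 i : ℕ) : ℚ) = (n : ℚ) / d ∧
      ((∑ i, p.2 i + (Finset.univ.filter fun i => 2 ≤ p.1 i).card : ℕ) : ℚ) = (k : ℚ) / d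

end PolygonDissection

end

noncomputable section

namespace PolygonDissection

open Finset Polynomial

/-! ### Noncrossing sets of arcs on an integer interval -/

/-! By Burnside's lemma, `n` times the number of classes is the sum over `d ∣ n` of `φ(d)` times the
number of dissections fixed by the rotation through `m = n / d` (`card_cyclicClasses_mul`). The term
`d = 1` is `A n k / n`.

For `d ≥ 2` a fixed dissection has a central cell, degenerating to a diameter when `d = 2`. Every
chord cuts off an arc of length at most `m`, since a longer one would cross its own rotation. Let `r
≥ 1` be the number of vertices of the central cell modulo `m`. Counting pairs (fixed dissection,
central vertex) shows that the fixed dissections with given `r` number `m / r` times those in which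
`0` is central (`numCentral_mul_card`); after division by `n` this is the weight `1 / (d r)`.

If `0` is central, the dissection is recovered from its arcs inside `[0, m]` by rotating them
(`spread`, with inverse `arcsIn`). The remaining central vertices are the points strictly inside
`[0, m]` that no arc covers, the breaks, so `r` is the number of breaks plus one. Each rotation
orbit has `d` chords, so there are `k / d` arcs, except that a diameter is the image of two copies
of the full arc.

Breaks cut `[0, m]` into `r` break-free pieces. A break-free piece of length `l ≥ 2` consists of its
full arc and a dissection of an `(l + 1)`-gon; a piece of length `1` is empty. This gives the sum
over compositions (`sum_compositionPairs`), used as it stands for `r ≥ 3`. For `r = 1` there is one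
factor, with `d = 2` treated apart because of the diameter. For `r = 2` the convolution of two
factors is evaluated by double counting the diagonals of all dissections of the `m`-gon
(`coeff_gf_one`), which produces the factor `n + k - d`. -/

/-- No two arcs of `S` strictly interlace. -/
def Noncrossing (S : Finset (ℤ × ℤ)) : Prop :=
  ∀ e ∈ S, ∀ f ∈ S, ¬ (e.1 < f.1 ∧ f.1 < e.2 ∧ e.2 < f.2)

open scoped Classical in
/-- The noncrossing sets of arcs of length at least two with endpoints in `[x, y]`. -/
def arcSets (x y : ℤ) : Finset (Finset (ℤ × ℤ)) :=
  {S ∈ (Icc x y ×ˢ Icc x y).powerset | (∀ e ∈ S, e.1 + 2 ≤ e.2) ∧ Noncrossing S}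

theorem mem_arcSets {x y : ℤ} {S : Finset (ℤ × ℤ)} :
    S ∈ arcSets x y ↔ (∀ e ∈ S, x ≤ e.1 ∧ e.1 + 2 ≤ e.2 ∧ e.2 ≤ y) ∧ Noncrossing S := by
  classical
  rw [arcSets, mem_filter, mem_powerset]
  constructor
  · rintro ⟨h1, h2, h3⟩
    refine ⟨fun e he => ?_, h3⟩
    have := h1 he
    rw [mem_product, mem_Icc, mem_Icc] at this
    exact ⟨this.1.1, h2 e he, this.2.2⟩
  · rintro ⟨h1, h3⟩
    refine ⟨fun e he => ?_, fun e he => (h1 e he).2.1, h3⟩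
    have := h1 e he
    rw [mem_product, mem_Icc, mem_Icc]
    omega

/-- The point `z` is a break of `S` if no arc of `S` strictly covers it. -/
def IsBreak (S : Finset (ℤ × ℤ)) (z : ℤ) : Prop :=
  ∀ e ∈ S, ¬ (e.1 < z ∧ z < e.2)

open scoped Classical in
/-- The breaks of `S` strictly between `x` and `y`. -/
def breaks (S : Finset (ℤ × ℤ)) (x y : ℤ) : Finset ℤ :=
  {z ∈ Ioo x y | IsBreak S z}

theorem mem_breaks {S : Finset (ℤ × ℤ)} {x y z : ℤ} :
    z ∈ breaks S x y ↔ (x < z ∧ z < y) ∧ IsBreak S z := by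
  classical
  rw [breaks, mem_filter, mem_Ioo]

theorem Noncrossing.mono {S T : Finset (ℤ × ℤ)} (h : Noncrossing T) (hST : S ⊆ T) :
    Noncrossing S := fun e he f hf => h e (hST he) f (hST hf)

open scoped Classical in
/-- Arc sets with a break at `z` are unions of arc sets on both sides of `z`. -/
theorem sum_isBreak {M : Type*} [AddCommMonoid M] {x y z : ℤ} (hx : x < z) (hy : z < y)
    (f : Finset (ℤ × ℤ) → M) :
    ∑ S ∈ arcSets x y with IsBreak S z, f S
      = ∑ p ∈ arcSets x z ×ˢ arcSets z y, f (p.1 ∪ p.2) := by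
  symm
  refine sum_bij' (fun p _ => p.1 ∪ p.2)
    (fun S _ => (S.filter fun e => e.2 ≤ z, S.filter fun e => z ≤ e.1)) ?_ ?_ ?_ ?_ ?_
  · rintro ⟨S, T⟩ h
    rw [mem_product, mem_arcSets, mem_arcSets] at h
    obtain ⟨⟨h1, h2⟩, h3, h4⟩ := h
    dsimp only at *
    rw [mem_filter, mem_arcSets]
    refine ⟨⟨fun e he => ?_, fun e he f hf => ?_⟩, fun e he => ?_⟩
    · rcases mem_union.1 he with he | he
      · have := h1 e he; omega
      · have := h3 e he; omega
    · rcases mem_union.1 he with he | he <;> rcases mem_union.1 hf with hf | hf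
      · exact h2 e he f hf
      · have := h1 e he; have := h3 f hf; omega
      · have := h3 e he; have := h1 f hf; omega
      · exact h4 e he f hf
    · rcases mem_union.1 he with he | he
      · have := h1 e he; omega
      · have := h3 e he; omega
  · intro S h
    rw [mem_filter, mem_arcSets] at h
    obtain ⟨⟨h1, h2⟩, -⟩ := h
    rw [mem_product, mem_arcSets, mem_arcSets]
    refine ⟨⟨fun e he => ?_, h2.mono (filter_subset _ _)⟩,
      fun e he => ?_, h2.mono (filter_subset _ _)⟩
    · have he := mem_filter.1 he
      have := h1 e he.1; omega
    · have he := mem_filter.1 he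
      have := h1 e he.1; omega
  · rintro ⟨S, T⟩ h
    rw [mem_product, mem_arcSets, mem_arcSets] at h
    obtain ⟨⟨h1, -⟩, h3, -⟩ := h
    dsimp only at *
    refine Prod.ext ?_ ?_
    · ext e
      simp only [mem_filter, mem_union]
      constructor
      · rintro ⟨he | he, h⟩
        · exact he
        · have := h3 e he; omega
      · intro he
        exact ⟨Or.inl he, (h1 e he).2.2⟩
    · ext e
      simp only [mem_filter, mem_union]
      constructor
      · rintro ⟨he | he, h⟩
        · have := h1 e he; omega
        · exact he
      · intro he
        exact ⟨Or.inr he, (h3 e he).1⟩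
  · intro S h
    rw [mem_filter] at h
    ext e
    simp only [mem_filter, mem_union]
    constructor
    · rintro (he | he) <;> exact he.1
    · intro he
      have := h.2 e he
      by_cases h' : e.2 ≤ z
      · exact Or.inl ⟨he, h'⟩
      · exact Or.inr ⟨he, by omega⟩
  · intros; rfl

theorem disjoint_of_arcSets {x y z : ℤ} {S T : Finset (ℤ × ℤ)} (hS : S ∈ arcSets x z)
    (hT : T ∈ arcSets z y) : Disjoint S T := by
  rw [mem_arcSets] at hS hT
  refine disjoint_left.2 fun e he he' => ?_
  have := hS.1 e he
  have := hT.1 e he'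
  omega

theorem breaks_union_left {x y z : ℤ} {S T : Finset (ℤ × ℤ)} (hT : T ∈ arcSets z y) :
    breaks (S ∪ T) x z = breaks S x z := by
  rw [mem_arcSets] at hT
  ext w
  rw [mem_breaks, mem_breaks]
  refine and_congr_right fun hw => ⟨fun h e he => h e (mem_union_left _ he), fun h e he => ?_⟩
  rcases mem_union.1 he with he | he
  · exact h e he
  · have := hT.1 e he; omega

theorem breaks_union_right {x y z : ℤ} {S T : Finset (ℤ × ℤ)} (hS : S ∈ arcSets x z) :
    breaks (S ∪ T) z y = breaks T z y := by
  rw [mem_arcSets] at hS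
  ext w
  rw [mem_breaks, mem_breaks]
  refine and_congr_right fun hw => ⟨fun h e he => h e (mem_union_right _ he), fun h e he => ?_⟩
  rcases mem_union.1 he with he | he
  · have := hS.1 e he; omega
  · exact h e he

/-- The number of breaks is additive when cutting at a break. -/
theorem card_breaks_split {x y z : ℤ} {S : Finset (ℤ × ℤ)} (hx : x < z) (hy : z < y)
    (hz : IsBreak S z) : (breaks S x y).card = (breaks S x z).card + (breaks S z y).card + 1 := by
  classical
  have h : breaks S x y = insert z (breaks S x z ∪ breaks S z y) := by
    ext w
    simp only [mem_insert, mem_union, mem_breaks]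
    constructor
    · rintro ⟨h1, h2⟩
      rcases lt_trichotomy w z with h | h | h
      · exact Or.inr (Or.inl ⟨⟨h1.1, h⟩, h2⟩)
      · exact Or.inl h
      · exact Or.inr (Or.inr ⟨⟨h, h1.2⟩, h2⟩)
    · rintro (rfl | h | h)
      · exact ⟨⟨hx, hy⟩, hz⟩
      · exact ⟨⟨h.1.1, h.1.2.trans hy⟩, h.2⟩
      · exact ⟨⟨hx.trans h.1.1, h.1.2⟩, h.2⟩
  rw [h, card_insert_of_notMem, card_union_of_disjoint]
  · refine disjoint_left.2 fun w h1 h2 => ?_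
    rw [mem_breaks] at h1 h2
    omega
  · simp only [mem_union, mem_breaks]
    omega

open scoped Classical in
/-- Generating polynomial, by number of arcs, of the arc sets on `[x, y]` with `s` breaks. -/
def gf (x y : ℤ) (s : ℕ) : ℚ[X] :=
  ∑ S ∈ arcSets x y with (breaks S x y).card = s, X ^ S.card

/-- Cut at the first break: the part to its left is break-free and the part to its right keeps the
other `s` breaks. After the order of summation is exchanged, every arc set contributes for exactly
one `z`. -/
theorem gf_succ_aux (x y : ℤ) (s : ℕ) :
    gf x y (s + 1) = ∑ z ∈ Ioo x y, gf x z 0 * gf z y s := by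
  classical
  have key : ∀ z ∈ Ioo x y, gf x z 0 * gf z y s =
      ∑ S ∈ (arcSets x y).filter (fun S => IsBreak S z),
        if breaks S x z = ∅ ∧ (breaks S z y).card = s then (X : ℚ[X]) ^ S.card else 0 := by
    intro z hz
    rw [mem_Ioo] at hz
    rw [sum_isBreak hz.1 hz.2, gf, gf, sum_mul_sum, sum_filter, sum_product]
    refine sum_congr rfl fun S hS => ?_
    split_ifs with h0
    · rw [sum_filter]
      refine sum_congr rfl fun T hT => ?_
      rw [card_eq_zero] at h0
      rw [breaks_union_left hT, breaks_union_right hS,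
        card_union_of_disjoint (disjoint_of_arcSets hS hT), pow_add]
      simp [h0]
    · symm
      refine sum_eq_zero fun T hT => ?_
      rw [breaks_union_left hT, if_neg]
      rintro ⟨h, -⟩
      exact h0 (by rw [h, card_empty])
  rw [sum_congr rfl key, gf, sum_filter]
  simp_rw [sum_filter]
  rw [sum_comm]
  refine sum_congr rfl fun S hS => ?_
  split_ifs with h
  · have hne : (breaks S x y).Nonempty := by rw [← card_pos, h]; omega
    set z := (breaks S x y).min' hne with hzdef
    have hz : z ∈ breaks S x y := min'_mem _ _
    have hz' := mem_breaks.1 hz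
    have h0 : breaks S x z = ∅ := by
      rw [eq_empty_iff_forall_notMem]
      intro w hw
      rw [mem_breaks] at hw
      have := min'_le (breaks S x y) w (mem_breaks.2 ⟨⟨hw.1.1, hw.1.2.trans hz'.1.2⟩, hw.2⟩)
      omega
    have hc := card_breaks_split hz'.1.1 hz'.1.2 hz'.2
    rw [h0, card_empty, h] at hc
    -- Any other admissible `w` would be a break to the right of the smallest one, so the part left
    -- of `w` would not be break-free.
    rw [sum_eq_single z]
    · rw [if_pos hz'.2, if_pos ⟨h0, by omega⟩]
    · intro w hw hwz
      rw [mem_Ioo] at hw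
      split_ifs with h1 h2
      · exfalso
        have h3 := min'_le (breaks S x y) w (mem_breaks.2 ⟨hw, h1⟩)
        have h4 : z ∈ breaks S x w := mem_breaks.2 ⟨⟨hz'.1.1, lt_of_le_of_ne h3 (Ne.symm hwz)⟩, hz'.2⟩
        rw [h2.1] at h4
        simp at h4
      · rfl
      · rfl
    · intro hw
      exact absurd (mem_Ioo.2 hz'.1) hw
  · symm
    refine sum_eq_zero fun z hz => ?_
    rw [mem_Ioo] at hz
    split_ifs with h1 h2
    · exfalso
      apply h
      rw [card_breaks_split hz.1 hz.2 h1, h2.1, h2.2]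
      simp
    · rfl
    · rfl

/-- Translation of an arc set. -/
def shift (t : ℤ) (S : Finset (ℤ × ℤ)) : Finset (ℤ × ℤ) :=
  S.map (Equiv.prodCongr (Equiv.addRight t) (Equiv.addRight t)).toEmbedding

theorem mem_shift {t : ℤ} {S : Finset (ℤ × ℤ)} {e : ℤ × ℤ} :
    e ∈ shift t S ↔ (e.1 - t, e.2 - t) ∈ S := by
  rw [shift, mem_map_equiv]
  rfl

theorem card_shift (t : ℤ) (S : Finset (ℤ × ℤ)) : (shift t S).card = S.card := card_map _

theorem shift_shift (t u : ℤ) (S : Finset (ℤ × ℤ)) : shift t (shift u S) = shift (t + u) S := by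
  ext e
  simp only [mem_shift]
  rw [sub_sub, sub_sub]

theorem shift_zero (S : Finset (ℤ × ℤ)) : shift 0 S = S := by
  ext e
  simp only [mem_shift, sub_zero]

theorem shift_mem_arcSets {x y t : ℤ} {S : Finset (ℤ × ℤ)} (h : S ∈ arcSets x y) :
    shift t S ∈ arcSets (x + t) (y + t) := by
  rw [mem_arcSets] at h ⊢
  refine ⟨fun e he => ?_, fun e he f hf => ?_⟩
  · have := h.1 _ (mem_shift.1 he)
    dsimp only at this
    omega
  · have := h.2 _ (mem_shift.1 he) _ (mem_shift.1 hf)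
    dsimp only at this
    omega

theorem isBreak_shift {t z : ℤ} {S : Finset (ℤ × ℤ)} :
    IsBreak (shift t S) (z + t) ↔ IsBreak S z := by
  constructor
  · intro h e he
    have := h (e.1 + t, e.2 + t) (mem_shift.2 (by simpa using he))
    dsimp only at this
    omega
  · intro h e he
    have := h _ (mem_shift.1 he)
    dsimp only at this
    omega

theorem card_breaks_shift (t x y : ℤ) (S : Finset (ℤ × ℤ)) :
    (breaks (shift t S) (x + t) (y + t)).card = (breaks S x y).card := by
  symm
  refine card_bij' (fun z _ => z + t) (fun z _ => z - t) ?_ ?_ ?_ ?_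
  · intro z hz
    rw [mem_breaks] at hz ⊢
    exact ⟨by omega, isBreak_shift.2 hz.2⟩
  · intro z hz
    rw [mem_breaks] at hz ⊢
    exact ⟨by omega, (isBreak_shift (t := t)).1 (by simpa using hz.2)⟩
  · intro z _; simp
  · intro z _; simp

theorem sum_arcSets_shift {M : Type*} [AddCommMonoid M] (x y t : ℤ) (f : Finset (ℤ × ℤ) → M) :
    ∑ S ∈ arcSets (x + t) (y + t), f S = ∑ S ∈ arcSets x y, f (shift t S) := by
  symm
  refine sum_bij' (fun S _ => shift t S) (fun S _ => shift (-t) S) ?_ ?_ ?_ ?_ ?_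
  · intro S hS; exact shift_mem_arcSets hS
  · intro S hS
    have := shift_mem_arcSets (t := -t) hS
    simpa using this
  · intro S _; rw [shift_shift, neg_add_cancel, shift_zero]
  · intro S _; rw [shift_shift, add_neg_cancel, shift_zero]
  · intros; rfl

theorem gf_shift (x y t : ℤ) (s : ℕ) : gf (x + t) (y + t) s = gf x y s := by
  classical
  rw [gf, gf, sum_filter, sum_filter, sum_arcSets_shift]
  simp_rw [card_breaks_shift, card_shift]

theorem gf_succ (m : ℤ) (s : ℕ) :
    gf 0 m (s + 1) = ∑ z ∈ Ioo 0 m, gf 0 z 0 * gf 0 (m - z) s := by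
  rw [gf_succ_aux]
  refine sum_congr rfl fun z _ => ?_
  have := gf_shift 0 (m - z) z s
  rw [zero_add, sub_add_cancel] at this
  rw [this]

/-- An arc set on an interval of length at least two without breaks contains the full arc. -/
theorem full_mem_of_breaks_eq_empty {x y : ℤ} (hxy : x + 2 ≤ y) {S : Finset (ℤ × ℤ)}
    (hS : S ∈ arcSets x y) (h : breaks S x y = ∅) : (x, y) ∈ S := by
  rw [mem_arcSets] at hS
  have hcov : ∀ z, x < z → z < y → ∃ e ∈ S, e.1 < z ∧ z < e.2 := by
    intro z h1 h2
    by_contra hcon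
    push Not at hcon
    have : z ∈ breaks S x y := mem_breaks.2 ⟨⟨h1, h2⟩, fun e he h3 => by
      have := hcon e he h3.1; omega⟩
    rw [h] at this
    simp at this
  classical
  set T := S.filter fun e => e.1 = x with hT
  have hTne : T.Nonempty := by
    obtain ⟨e, he, h1, h2⟩ := hcov (x + 1) (by omega) (by omega)
    exact ⟨e, mem_filter.2 ⟨he, by have := hS.1 e he; omega⟩⟩
  -- Take the longest arc starting at `x`. If it stopped before `y`, an arc covering its right end
  -- would either interlace with it or be a longer arc from `x`.
  obtain ⟨e, he, hmax⟩ := exists_max_image T (fun e => e.2) hTne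
  obtain ⟨he, hex⟩ := mem_filter.1 he
  have h1 := hS.1 e he
  by_cases hy : e.2 = y
  · have : e = (x, y) := Prod.ext hex hy
    rwa [← this]
  · exfalso
    obtain ⟨f, hf, h2, h3⟩ := hcov e.2 (by omega) (by omega)
    have h4 := hS.2 e he f hf
    have h5 := hS.1 f hf
    have h6 := hmax f (mem_filter.2 ⟨hf, by omega⟩)
    omega

theorem breaks_eq_empty_of_full_mem {x y : ℤ} {S : Finset (ℤ × ℤ)} (h : (x, y) ∈ S) :
    breaks S x y = ∅ := by
  rw [eq_empty_iff_forall_notMem]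
  intro z hz
  rw [mem_breaks] at hz
  exact hz.2 _ h hz.1

open scoped Classical in
/-- The arc sets on `[x, y]` without the full arc. -/
def properSets (x y : ℤ) : Finset (Finset (ℤ × ℤ)) :=
  (arcSets x y).filter fun S => (x, y) ∉ S

theorem mem_properSets {x y : ℤ} {S : Finset (ℤ × ℤ)} :
    S ∈ properSets x y ↔ S ∈ arcSets x y ∧ (x, y) ∉ S := by
  rw [properSets, mem_filter]

theorem insert_full_mem {x y : ℤ} (hxy : x + 2 ≤ y) {S : Finset (ℤ × ℤ)} (hS : S ∈ arcSets x y) :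
    insert (x, y) S ∈ arcSets x y := by
  rw [mem_arcSets] at hS ⊢
  refine ⟨fun e he => ?_, fun e he f hf => ?_⟩
  · rcases mem_insert.1 he with rfl | he
    · omega
    · exact hS.1 e he
  · rcases mem_insert.1 he with rfl | he <;> rcases mem_insert.1 hf with rfl | hf
    · dsimp only; omega
    · have := hS.1 f hf; omega
    · have := hS.1 e he; omega
    · exact hS.2 e he f hf

theorem subset_mem_arcSets {x y : ℤ} {S T : Finset (ℤ × ℤ)} (hT : T ∈ arcSets x y) (h : S ⊆ T) :
    S ∈ arcSets x y := by
  rw [mem_arcSets] at hT ⊢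
  exact ⟨fun e he => hT.1 e (h he), hT.2.mono h⟩

/-- Generating polynomial of the proper arc sets on `[0, p]`. -/
def properGf (p : ℤ) : ℚ[X] := ∑ S ∈ properSets 0 p, X ^ S.card

/-- Break-free means containing the full arc, and erasing it costs one factor `X`. A unit interval
has no such arc (`gf_one_zero`); this difference is the source of the term `|{i : n_i ≥ 2}|`. -/
theorem gf_zero_of_two_le {p : ℤ} (hp : 2 ≤ p) : gf 0 p 0 = X * properGf p := by
  classical
  rw [gf, properGf, mul_sum]
  symm
  refine sum_bij' (fun S _ => insert (0, p) S) (fun S _ => S.erase (0, p)) ?_ ?_ ?_ ?_ ?_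
  · intro S hS
    rw [mem_properSets] at hS
    rw [mem_filter]
    refine ⟨insert_full_mem (by omega) hS.1, ?_⟩
    rw [breaks_eq_empty_of_full_mem (mem_insert_self _ _), card_empty]
  · intro S hS
    rw [mem_filter] at hS
    rw [mem_properSets]
    exact ⟨subset_mem_arcSets hS.1 (erase_subset _ _), notMem_erase _ _⟩
  · intro S hS
    exact erase_insert (mem_properSets.1 hS).2
  · intro S hS
    rw [mem_filter, card_eq_zero] at hS
    exact insert_erase (full_mem_of_breaks_eq_empty (by omega) hS.1 hS.2)
  · intro S hS
    rw [card_insert_of_notMem (mem_properSets.1 hS).2, pow_succ']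

/-! ### Unit intervals and the bound on the number of arcs -/

theorem arcSets_eq_of_le {x y : ℤ} (h : y ≤ x + 1) : arcSets x y = {∅} := by
  ext S
  rw [mem_singleton]
  constructor
  · intro hS
    rw [mem_arcSets] at hS
    rw [eq_empty_iff_forall_notMem]
    intro e he
    have := hS.1 e he
    omega
  · rintro rfl
    rw [mem_arcSets]
    simp [Noncrossing]

theorem properSets_eq_of_le {x y : ℤ} (h : y ≤ x + 1) : properSets x y = {∅} := by
  rw [properSets, arcSets_eq_of_le h, filter_singleton, if_pos (by simp)]

theorem gf_one_zero : gf 0 1 0 = 1 := by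
  classical
  have : breaks ∅ 0 1 = ∅ := by
    rw [eq_empty_iff_forall_notMem]
    intro z hz
    rw [mem_breaks] at hz
    omega
  rw [gf, arcSets_eq_of_le (by norm_num), filter_singleton, this]
  simp

theorem properGf_one : properGf 1 = 1 := by
  rw [properGf, properSets_eq_of_le (by norm_num)]
  simp

/-- A noncrossing set of arcs on an interval of length `ℓ + 1` has at most `ℓ` arcs. -/
theorem card_le_of_mem_arcSets (ℓ : ℕ) : ∀ {x y : ℤ}, y = x + ℓ + 1 → ∀ {S : Finset (ℤ × ℤ)},
    S ∈ arcSets x y → S.card ≤ ℓ ∧ ((x, y) ∉ S → S.card ≤ ℓ - 1) := by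
  classical
  induction ℓ using Nat.strong_induction_on with
  | _ ℓ ih =>
    intro x y hxy S hS
    rcases Nat.eq_zero_or_pos ℓ with rfl | hℓ
    · rw [arcSets_eq_of_le (by simp at hxy; omega), mem_singleton] at hS
      simp [hS]
    -- Without the full arc there is a break `z`, and induction on both sides bounds the size by `(z
    -- - x - 1) + (y - z - 1) = ℓ - 1`.
    have hproper : ∀ T ∈ arcSets x y, (x, y) ∉ T → T.card + 1 ≤ ℓ := by
      intro T hT hxyT
      have hne : (breaks T x y).Nonempty := by
        rw [nonempty_iff_ne_empty]
        intro h
        exact hxyT (full_mem_of_breaks_eq_empty (by omega) hT h)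
      obtain ⟨z, hz⟩ := hne
      rw [mem_breaks] at hz
      have h1 : (T.filter fun e => e.2 ≤ z).card ≤ (z - x - 1).toNat := by
        refine (ih (z - x - 1).toNat (by omega) (x := x) (y := z) (by omega) ?_).1
        rw [mem_arcSets] at hT ⊢
        refine ⟨fun e he => ?_, hT.2.mono (filter_subset _ _)⟩
        have he := mem_filter.1 he
        have := hT.1 e he.1; omega
      have h2 : (T.filter fun e => ¬ e.2 ≤ z).card ≤ (y - z - 1).toNat := by
        refine (ih (y - z - 1).toNat (by omega) (x := z) (y := y) (by omega) ?_).1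
        rw [mem_arcSets] at hT ⊢
        refine ⟨fun e he => ?_, hT.2.mono (filter_subset _ _)⟩
        have he := mem_filter.1 he
        have := hT.1 e he.1
        have := hz.2 e he.1
        omega
      have h3 := card_filter_add_card_filter_not (s := T) (fun e => e.2 ≤ z)
      omega
    refine ⟨?_, fun h => by have := hproper S hS h; omega⟩
    by_cases h : (x, y) ∈ S
    · have h1 := hproper _ (subset_mem_arcSets hS (erase_subset (x, y) S)) (notMem_erase _ _)
      rw [card_erase_add_one h] at h1
      exact h1
    · have := hproper S hS h; omega

/-! ### Integer labels for the vertices of the polygon -/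

/-- The vertex of the `n`-gon with integer label `a`. -/
def vtx (n : ℕ) [NeZero n] (a : ℤ) : Fin n :=
  ⟨(a % n).toNat, by
    have hn : (0 : ℤ) < n := by exact_mod_cast NeZero.pos n
    have := Int.emod_nonneg a hn.ne'
    have := Int.emod_lt_of_pos a hn
    omega⟩

section Vertices

variable {n : ℕ} [NeZero n]

theorem coe_vtx (a : ℤ) : ((vtx n a : ℕ) : ℤ) = a % n := by
  have hn : (0 : ℤ) < n := by exact_mod_cast NeZero.pos n
  exact Int.toNat_of_nonneg (Int.emod_nonneg a hn.ne')

theorem coe_vtx_of_lt {a : ℤ} (h0 : 0 ≤ a) (h1 : a < n) : ((vtx n a : ℕ) : ℤ) = a := by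
  rw [coe_vtx, Int.emod_eq_of_lt h0 h1]

theorem vtx_eq_iff {a b : ℤ} : vtx n a = vtx n b ↔ (n : ℤ) ∣ a - b := by
  rw [Fin.ext_iff, ← Int.natCast_inj, coe_vtx, coe_vtx]
  rw [dvd_sub_comm]
  exact Int.modEq_iff_dvd

theorem exists_vtx (x : Fin n) : ∃ a : ℤ, 0 ≤ a ∧ a < n ∧ vtx n a = x := by
  refine ⟨(x : ℕ), by positivity, by exact_mod_cast x.isLt, ?_⟩
  rw [Fin.ext_iff, ← Int.natCast_inj, coe_vtx_of_lt (by positivity) (by exact_mod_cast x.isLt)]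

theorem vtx_add_self (a : ℤ) : vtx n (a + n) = vtx n a := by
  rw [vtx_eq_iff]; simp

theorem vtx_sub_self (a : ℤ) : vtx n (a - n) = vtx n a := by
  rw [vtx_eq_iff]; simp

theorem vtx_self : vtx n n = vtx n 0 := by
  rw [vtx_eq_iff]; simp

theorem vtx_add_mul (a q : ℤ) : vtx n (a + q * n) = vtx n a := by
  rw [vtx_eq_iff]; simp

theorem vtx_add_congr {a b : ℤ} (h : vtx n a = vtx n b) (c : ℤ) : vtx n (a + c) = vtx n (b + c) := by
  rw [vtx_eq_iff] at h ⊢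
  simpa using h

theorem finRotate_vtx (a : ℤ) : finRotate n (vtx n a) = vtx n (a + 1) := by
  obtain ⟨b, h0, h1, hb⟩ := exists_vtx (vtx n a)
  rw [← vtx_add_congr hb, ← hb]
  obtain ⟨m, rfl⟩ : ∃ m, n = m + 1 := ⟨n - 1, by have := NeZero.pos n; omega⟩
  have hv := coe_vtx_of_lt h0 h1
  rw [Fin.ext_iff, ← Int.natCast_inj]
  by_cases hl : vtx (m + 1) b = Fin.last m
  · rw [hl] at hv
    rw [hl, finRotate_last, coe_vtx, ← hv]
    simp
  · have hne : b ≠ m := by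
      intro h
      apply hl
      rw [Fin.ext_iff, ← Int.natCast_inj, hv, h]
      simp
    rw [coe_finRotate_of_ne_last hl, coe_vtx_of_lt (by omega) (by push_cast at *; omega)]
    push_cast
    rw [hv]

theorem finRotate_pow_vtx (i : ℕ) (a : ℤ) : (finRotate n ^ i) (vtx n a) = vtx n (a + i) := by
  induction i with
  | zero => simp
  | succ i ih =>
    rw [pow_succ', Equiv.Perm.mul_apply, ih, finRotate_vtx]
    push_cast
    rw [add_assoc]

theorem vtx_ne {a b : ℤ} (h0 : a < b) (h1 : b < a + n) : vtx n a ≠ vtx n b := by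
  intro h
  rw [eq_comm, vtx_eq_iff] at h
  have := Int.le_of_dvd (by omega) h
  omega

theorem isDiagonal_vtx {a b : ℤ} (h0 : a < b) (h1 : b < a + n) :
    IsDiagonal s(vtx n a, vtx n b) ↔ a + 2 ≤ b ∧ b + 2 ≤ a + n := by
  have hside : IsSide s(vtx n a, vtx n b) ↔ b = a + 1 ∨ b + 1 = a + n := by
    constructor
    · rintro ⟨v, hv⟩
      obtain ⟨c, -, -, rfl⟩ := exists_vtx v
      rw [finRotate_vtx, Sym2.eq_iff] at hv
      rcases hv with ⟨h2, h3⟩ | ⟨h2, h3⟩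
      · rw [← vtx_add_congr h2, vtx_eq_iff] at h3
        by_contra hcon
        have := Int.le_of_dvd (by omega) h3
        omega
      · rw [← vtx_add_congr h3, vtx_eq_iff, ← dvd_neg] at h2
        by_contra hcon
        have := Int.le_of_dvd (by omega) h2
        omega
    · rintro (rfl | h)
      · exact ⟨vtx n a, by rw [finRotate_vtx]⟩
      · exact ⟨vtx n b, by rw [finRotate_vtx, h, vtx_add_self, Sym2.eq_swap]⟩
  rw [IsDiagonal, hside, Sym2.mk_isDiag_iff]
  have := vtx_ne h0 h1
  constructor
  · rintro ⟨-, h⟩; omega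
  · intro h
    exact ⟨this, by omega⟩

/-- `Crosses` uses the linear order of `Fin n`, so labels are first translated to have `0 ≤ a < n`.
The cases then record how many of `c`, `b`, `d` pass `n`: those points move to the front, and a
cyclic shift of four interlacing points still interlaces. -/
theorem crosses_vtx {a b c d : ℤ} (h1 : a < c) (h2 : c < b) (h3 : b < d) (h4 : d < a + n) :
    Crosses s(vtx n a, vtx n b) s(vtx n c, vtx n d) := by
  have hn : (0 : ℤ) < n := by exact_mod_cast NeZero.pos n
  wlog h0 : 0 ≤ a ∧ a < n generalizing a b c d
  · have key := this (a := a % n) (b := b - a / n * n) (c := c - a / n * n) (d := d - a / n * n)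
    have e1 : a % n = a - a / n * n := by
      rw [Int.emod_def, mul_comm]
    have e2 := Int.emod_nonneg a hn.ne'
    have e3 := Int.emod_lt_of_pos a hn
    have := key (by omega) (by omega) (by omega) (by omega) ⟨e2, e3⟩
    rw [e1] at this
    have hs : ∀ z : ℤ, vtx n (z - a / n * n) = vtx n z := fun z => by
      rw [vtx_eq_iff]; simp
    simpa only [hs] using this
  have hlt : ∀ {x y : ℤ}, 0 ≤ x → x < y → y < n → vtx n x < vtx n y := by
    intro x y hx hxy hy
    rw [Fin.lt_def]
    have e1 := coe_vtx_of_lt hx (hxy.trans hy)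
    have e2 := coe_vtx_of_lt (hx.trans hxy.le) hy
    omega
  by_cases hd : d < n
  · exact ⟨vtx n a, vtx n c, vtx n b, vtx n d, hlt (by omega) (by omega) (by omega),
      hlt (by omega) (by omega) (by omega), hlt (by omega) (by omega) (by omega),
      Or.inl ⟨rfl, rfl⟩⟩
  by_cases hb : b < n
  · refine ⟨vtx n (d - n), vtx n a, vtx n c, vtx n b, hlt (by omega) (by omega) (by omega),
      hlt (by omega) (by omega) (by omega), hlt (by omega) (by omega) (by omega),
      Or.inr ⟨rfl, ?_⟩⟩
    rw [vtx_sub_self, Sym2.eq_swap]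
  by_cases hc : c < n
  · refine ⟨vtx n (b - n), vtx n (d - n), vtx n a, vtx n c, hlt (by omega) (by omega) (by omega),
      hlt (by omega) (by omega) (by omega), hlt (by omega) (by omega) (by omega),
      Or.inl ⟨?_, ?_⟩⟩
    · rw [vtx_sub_self, Sym2.eq_swap]
    · rw [vtx_sub_self, Sym2.eq_swap]
  · refine ⟨vtx n (c - n), vtx n (b - n), vtx n (d - n), vtx n a,
      hlt (by omega) (by omega) (by omega),
      hlt (by omega) (by omega) (by omega), hlt (by omega) (by omega) (by omega),
      Or.inr ⟨?_, ?_⟩⟩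
    · rw [vtx_sub_self, Sym2.eq_swap]
    · rw [vtx_sub_self, vtx_sub_self]

theorem Crosses.symm {n : ℕ} {e f : Sym2 (Fin n)} (h : Crosses e f) : Crosses f e := by
  obtain ⟨a, c, b, d, h1, h2, h3, h4⟩ := h
  exact ⟨a, c, b, d, h1, h2, h3, h4.symm.imp (fun h => h.symm) fun h => h.symm⟩

theorem Crosses.exists_vtx {e f : Sym2 (Fin n)} (h : Crosses e f) :
    ∃ a c b d : ℤ, 0 ≤ a ∧ a < c ∧ c < b ∧ b < d ∧ d < n ∧
      ((e = s(vtx n a, vtx n b) ∧ f = s(vtx n c, vtx n d)) ∨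
        (e = s(vtx n c, vtx n d) ∧ f = s(vtx n a, vtx n b))) := by
  obtain ⟨a, c, b, d, h1, h2, h3, h4⟩ := h
  have hv : ∀ x : Fin n, vtx n (x : ℕ) = x := fun x => by
    rw [Fin.ext_iff, ← Int.natCast_inj, coe_vtx_of_lt (by positivity) (by exact_mod_cast x.isLt)]
  refine ⟨(a : ℕ), (c : ℕ), (b : ℕ), (d : ℕ), by positivity, by exact_mod_cast h1,
    by exact_mod_cast h2, by exact_mod_cast h3, by exact_mod_cast d.isLt, ?_⟩
  simpa only [hv] using h4

theorem exists_chord {e : Sym2 (Fin n)} (he : ¬ e.IsDiag) :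
    ∃ a b : ℤ, 0 ≤ a ∧ a < b ∧ b < n ∧ e = s(vtx n a, vtx n b) := by
  induction e using Sym2.ind with
  | _ x y =>
    obtain ⟨a, ha0, ha1, rfl⟩ := exists_vtx x
    obtain ⟨b, hb0, hb1, rfl⟩ := exists_vtx y
    rw [Sym2.mk_isDiag_iff] at he
    rcases lt_trichotomy a b with h | rfl | h
    · exact ⟨a, b, ha0, h, hb1, rfl⟩
    · exact absurd rfl he
    · exact ⟨b, a, hb0, h, ha1, Sym2.eq_swap⟩

/-- Two arcs of the window `[0, n]` give the same chord only if they are equal or are the two arcs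
`(0, c)` and `(c, n)`. -/
theorem chord_eq_cases {a b c d : ℤ} (ha : 0 ≤ a) (hab : a < b) (hb : b ≤ n)
    (hc : 0 ≤ c) (hcd : c < d) (hd : d ≤ n)
    (h : s(vtx n a, vtx n b) = s(vtx n c, vtx n d)) :
    (a = c ∧ b = d) ∨ (a = 0 ∧ d = n ∧ b = c) ∨ (c = 0 ∧ b = n ∧ d = a) := by
  have key : ∀ x y : ℤ, vtx n x = vtx n y → x - y < n → y - x < n → x = y := by
    intro x y hxy h1 h2
    rcases lt_trichotomy x y with h | h | h
    · exact absurd hxy (vtx_ne h (by omega))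
    · exact h
    · exact absurd hxy.symm (vtx_ne h (by omega))
  -- In the closed window `[0, n]` the only two labels naming the same vertex are `0` and `n`.
  have key2 : ∀ x y : ℤ, vtx n x = vtx n y → 0 ≤ x → x < n → 0 < y → y ≤ n →
      x = y ∨ (x = 0 ∧ y = n) := by
    intro x y hxy h1 h2 h3 h4
    by_cases h5 : y = n
    · subst h5
      by_cases h6 : x = 0
      · exact Or.inr ⟨h6, rfl⟩
      · exact Or.inl (key _ _ hxy (by omega) (by omega))
    · exact Or.inl (key _ _ hxy (by omega) (by omega))
  rw [Sym2.eq_iff] at h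
  rcases h with ⟨h1, h2⟩ | ⟨h1, h2⟩
  · have e1 := key _ _ h1 (by omega) (by omega)
    have e2 := key _ _ h2 (by omega) (by omega)
    exact Or.inl ⟨e1, e2⟩
  · have e1 := key2 _ _ h1 (by omega) (by omega) (by omega) (by omega)
    have e2 := key2 _ _ h2.symm (by omega) (by omega) (by omega) (by omega)
    omega

/-- Arcs of the window `[0, n]` whose chords cross do interlace. -/
theorem Crosses.interlace {a b c d : ℤ} (ha : 0 ≤ a) (hab : a < b) (hb : b ≤ n)
    (hc : 0 ≤ c) (hcd : c < d) (hd : d ≤ n)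
    (h : Crosses s(vtx n a, vtx n b) s(vtx n c, vtx n d)) :
    (a < c ∧ c < b ∧ b < d) ∨ (c < a ∧ a < d ∧ d < b) := by
  obtain ⟨p, q, r, s, hp, hpq, hqr, hrs, hs, ⟨h1, h2⟩ | ⟨h1, h2⟩⟩ := h.exists_vtx
  · have e1 := chord_eq_cases ha hab hb hp (hpq.trans hqr) (by omega) h1
    have e2 := chord_eq_cases hc hcd hd (by omega) (hqr.trans hrs) (by omega) h2
    omega
  · have e1 := chord_eq_cases ha hab hb (by omega) (hqr.trans hrs) (by omega) h1
    have e2 := chord_eq_cases hc hcd hd hp (hpq.trans hqr) (by omega) h2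
    omega

end Vertices

/-! ### Dissections and arc sets -/

/-- `D` consists of pairwise noncrossing diagonals. -/
def IsDis {n : ℕ} (D : Finset (Sym2 (Fin n))) : Prop :=
  (∀ e ∈ D, IsDiagonal e) ∧ ∀ e ∈ D, ∀ f ∈ D, ¬ Crosses e f

theorem isDissection_iff {n k : ℕ} {D : Finset (Sym2 (Fin n))} :
    IsDissection n k D ↔ D.card = k ∧ IsDis D := Iff.rfl

open scoped Classical in
/-- All dissections of the `n`-gon. -/
def dissections (n : ℕ) : Finset (Finset (Sym2 (Fin n))) := {D | IsDis D}

theorem mem_dissections {n : ℕ} {D : Finset (Sym2 (Fin n))} : D ∈ dissections n ↔ IsDis D := by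
  classical
  simp [dissections]

section Glue

variable {n : ℕ} [NeZero n]

/-- The chords given by a set of arcs. -/
def toChords (n : ℕ) [NeZero n] (T : Finset (ℤ × ℤ)) : Finset (Sym2 (Fin n)) :=
  T.image fun e => s(vtx n e.1, vtx n e.2)

theorem mem_toChords {T : Finset (ℤ × ℤ)} {f : Sym2 (Fin n)} :
    f ∈ toChords n T ↔ ∃ e ∈ T, s(vtx n e.1, vtx n e.2) = f := by
  rw [toChords, mem_image]

/-- The arcs inside `[x, y]` whose chords belong to `D`. -/
def arcsIn (D : Finset (Sym2 (Fin n))) (x y : ℤ) : Finset (ℤ × ℤ) :=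
  (Icc x y ×ˢ Icc x y).filter fun e => e.1 + 2 ≤ e.2 ∧ s(vtx n e.1, vtx n e.2) ∈ D

theorem mem_arcsIn {D : Finset (Sym2 (Fin n))} {x y : ℤ} {e : ℤ × ℤ} :
    e ∈ arcsIn D x y ↔ (x ≤ e.1 ∧ e.1 + 2 ≤ e.2 ∧ e.2 ≤ y) ∧ s(vtx n e.1, vtx n e.2) ∈ D := by
  rw [arcsIn, mem_filter, mem_product, mem_Icc, mem_Icc]
  constructor
  · rintro ⟨h1, h2, h3⟩; exact ⟨by omega, h3⟩
  · rintro ⟨h1, h2⟩; exact ⟨by omega, by omega, h2⟩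

theorem arcsIn_mem_arcSets {D : Finset (Sym2 (Fin n))} (hD : IsDis D) {x y : ℤ} (h : y < x + n) :
    arcsIn D x y ∈ arcSets x y := by
  rw [mem_arcSets]
  refine ⟨fun e he => (mem_arcsIn.1 he).1, fun e he f hf hef => ?_⟩
  rw [mem_arcsIn] at he hf
  exact hD.2 _ he.2 _ hf.2 (crosses_vtx hef.1 hef.2.1 hef.2.2 (by omega))

open scoped Classical in
/-- Dissections whose chords neither cross nor equal the chord `{0, b}` are glued from proper arc
sets on the two sides of this chord. -/
theorem sum_glue {b : ℤ} (hb0 : 0 < b) (hbn : b < n) :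
    ∑ D ∈ dissections n with s(vtx n 0, vtx n b) ∉ D ∧ ∀ e ∈ D, ¬ Crosses e s(vtx n 0, vtx n b),
      (X : ℚ[X]) ^ D.card = properGf b * properGf (n - b) := by
  -- The second factor is moved to `[b, n]`, so that both sides of the chord live in the window `[0,
  -- n]`.
  have hshift : properGf (n - b) = ∑ T ∈ properSets b n, (X : ℚ[X]) ^ T.card := by
    have h := sum_arcSets_shift 0 (n - b) b (fun S => if (b, (n : ℤ)) ∉ S then (X : ℚ[X]) ^ S.card else 0)
    rw [zero_add, sub_add_cancel] at h
    rw [properGf, properSets, properSets, sum_filter, sum_filter, h]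
    simp_rw [mem_shift, sub_self, card_shift]
  rw [hshift, properGf, sum_mul_sum, ← sum_product']
  symm
  have hdisj : ∀ p ∈ properSets 0 b ×ˢ properSets b n, ∀ e ∈ p.1 ∪ p.2,
      0 ≤ e.1 ∧ e.1 + 2 ≤ e.2 ∧ e.2 ≤ n ∧ (e.2 ≤ b ∨ b ≤ e.1) ∧ e ≠ (0, b) ∧ e ≠ (b, (n : ℤ)) := by
    rintro ⟨S, T⟩ hp e he
    rw [mem_product, mem_properSets, mem_properSets, mem_arcSets, mem_arcSets] at hp
    obtain ⟨⟨⟨h1, -⟩, h2⟩, ⟨h3, -⟩, h4⟩ := hp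
    dsimp only at *
    rcases mem_union.1 he with h | h
    · have := h1 e h
      refine ⟨by omega, by omega, by omega, by omega, ?_, ?_⟩
      · rintro rfl; exact h2 h
      · rintro rfl; dsimp only at this; omega
    · have := h3 e h
      refine ⟨by omega, by omega, by omega, by omega, ?_, ?_⟩
      · rintro rfl; dsimp only at this; omega
      · rintro rfl; exact h4 h
  -- Two arcs give one chord only as `(0, c)` and `(c, n)`. Here that forces `c = b`, and both of
  -- these arcs are excluded by properness.
  have hinj : ∀ p ∈ properSets 0 b ×ˢ properSets b n, ∀ e ∈ p.1 ∪ p.2, ∀ f ∈ p.1 ∪ p.2,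
      s(vtx n e.1, vtx n e.2) = s(vtx n f.1, vtx n f.2) → e = f := by
    intro p hp e he f hf hef
    have h1 := hdisj p hp e he
    have h2 := hdisj p hp f hf
    simp only [ne_eq, Prod.ext_iff] at h1 h2
    have h3 := chord_eq_cases h1.1 (by omega) h1.2.2.1 h2.1 (by omega) h2.2.2.1 hef
    rw [Prod.ext_iff]
    omega
  refine sum_bij' (fun p _ => toChords n (p.1 ∪ p.2))
    (fun D _ => (arcsIn D 0 b, arcsIn D b n)) ?_ ?_ ?_ ?_ ?_
  · intro p hp
    have hnc : Noncrossing (p.1 ∪ p.2) := by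
      rw [mem_product, mem_properSets, mem_properSets, mem_arcSets, mem_arcSets] at hp
      obtain ⟨⟨⟨h1, h1'⟩, h2⟩, ⟨h3, h3'⟩, h4⟩ := hp
      intro e he f hf
      rcases mem_union.1 he with he | he <;> rcases mem_union.1 hf with hf | hf
      · exact h1' e he f hf
      · have := h1 e he; have := h3 f hf; omega
      · have := h3 e he; have := h1 f hf; omega
      · exact h3' e he f hf
    have hd := hdisj p hp
    rw [mem_filter, mem_dissections]
    refine ⟨⟨fun e he => ?_, fun e he f hf hef => ?_⟩, fun h => ?_, fun e he hc => ?_⟩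
    · obtain ⟨a, ha, rfl⟩ := mem_toChords.1 he
      have := hd a ha
      simp only [ne_eq, Prod.ext_iff] at this
      rw [isDiagonal_vtx (by omega) (by omega)]
      constructor
      · omega
      · omega
    · obtain ⟨a, ha, rfl⟩ := mem_toChords.1 he
      obtain ⟨c, hc, rfl⟩ := mem_toChords.1 hf
      have h1 := hd a ha
      have h2 := hd c hc
      rcases hef.interlace h1.1 (by omega) h1.2.2.1 h2.1 (by omega) h2.2.2.1 with h | h
      · exact hnc a ha c hc h
      · exact hnc c hc a ha h
    · obtain ⟨a, ha, h⟩ := mem_toChords.1 h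
      have h1 := hd a ha
      simp only [ne_eq, Prod.ext_iff] at h1
      have := chord_eq_cases h1.1 (by omega) h1.2.2.1 le_rfl hb0 hbn.le h
      omega
    · obtain ⟨a, ha, rfl⟩ := mem_toChords.1 he
      have h1 := hd a ha
      have := hc.interlace h1.1 (by omega) h1.2.2.1 le_rfl hb0 hbn.le
      omega
  · intro D hD
    rw [mem_filter, mem_dissections] at hD
    rw [mem_product, mem_properSets, mem_properSets]
    refine ⟨⟨arcsIn_mem_arcSets hD.1 (by omega), fun h => ?_⟩,
      arcsIn_mem_arcSets hD.1 (by omega), fun h => ?_⟩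
    · exact hD.2.1 (mem_arcsIn.1 h).2
    · have := (mem_arcsIn.1 h).2
      dsimp only at this
      rw [vtx_self, Sym2.eq_swap] at this
      exact hD.2.1 this
  · intro p hp
    have hd := hdisj p hp
    have hp' := hp
    rw [mem_product, mem_properSets, mem_properSets, mem_arcSets, mem_arcSets] at hp'
    obtain ⟨⟨⟨h1, h1'⟩, h2⟩, ⟨h3, h3'⟩, h4⟩ := hp'
    have back : ∀ e : ℤ × ℤ, 0 ≤ e.1 → e.1 + 2 ≤ e.2 → e.2 ≤ n → (e.2 ≤ b ∨ b ≤ e.1) →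
        s(vtx n e.1, vtx n e.2) ∈ toChords n (p.1 ∪ p.2) → e ∈ p.1 ∪ p.2 := by
      intro e h5 h6 h7 h8 h9
      obtain ⟨f, hf, h9⟩ := mem_toChords.1 h9
      have h10 := hd f hf
      have : e = f := by
        simp only [ne_eq, Prod.ext_iff] at h10
        have := chord_eq_cases h10.1 (by omega) h10.2.2.1 h5 (by omega) h7 h9
        rw [Prod.ext_iff]
        omega
      rwa [this]
    refine Prod.ext ?_ ?_
    · ext e
      dsimp only
      rw [mem_arcsIn]
      constructor
      · rintro ⟨h5, h6⟩
        rcases mem_union.1 (back e (by omega) (by omega) (by omega) (by omega) h6) with h | h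
        · exact h
        · have := h3 e h; omega
      · intro he
        exact ⟨h1 e he, mem_toChords.2 ⟨e, mem_union_left _ he, rfl⟩⟩
    · ext e
      dsimp only
      rw [mem_arcsIn]
      constructor
      · rintro ⟨h5, h6⟩
        rcases mem_union.1 (back e (by omega) (by omega) (by omega) (by omega) h6) with h | h
        · have := h1 e h; omega
        · exact h
      · intro he
        exact ⟨h3 e he, mem_toChords.2 ⟨e, mem_union_right _ he, rfl⟩⟩
  · intro D hD
    rw [mem_filter, mem_dissections] at hD
    ext f
    rw [mem_toChords]
    constructor
    · rintro ⟨e, he, rfl⟩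
      rcases mem_union.1 he with he | he <;> exact (mem_arcsIn.1 he).2
    · intro hf
      obtain ⟨a, c, ha, hac, hc, rfl⟩ := exists_chord (hD.1.1 f hf).1
      have hdiag := (isDiagonal_vtx hac (by omega)).1 (hD.1.1 _ hf)
      by_cases h1 : c ≤ b
      · exact ⟨(a, c), mem_union_left _ (mem_arcsIn.2 ⟨⟨ha, hdiag.1, h1⟩, hf⟩), rfl⟩
      by_cases h2 : b ≤ a
      · exact ⟨(a, c), mem_union_right _ (mem_arcsIn.2 ⟨⟨h2, hdiag.1, hc.le⟩, hf⟩), rfl⟩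
      -- A chord from `0` to a point beyond `b` belongs to the second side, where its arc is `(c,
      -- n)`.
      by_cases h3 : a = 0
      · subst h3
        have hs : s(vtx n c, vtx n n) = s(vtx n 0, vtx n c) := by rw [vtx_self, Sym2.eq_swap]
        refine ⟨(c, n), mem_union_right _ (mem_arcsIn.2 ⟨⟨?_, ?_, le_rfl⟩, ?_⟩), hs⟩
        · dsimp only; omega
        · dsimp only; omega
        · rw [hs]; exact hf
      · exact absurd (crosses_vtx (by omega) (by omega) (by omega) (by omega)).symm
          (hD.2.2 _ hf)
  · intro p hp
    have : Disjoint p.1 p.2 := by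
      rw [mem_product, mem_properSets, mem_properSets] at hp
      exact disjoint_of_arcSets hp.1.1 hp.2.1
    rw [toChords, card_image_of_injOn, card_union_of_disjoint this, pow_add]
    intro e he f hf
    exact hinj p hp e he f hf

end Glue

/-! ### The numbers of dissections and their convolution -/

theorem coeff_sum_X_pow {α : Type*} (F : Finset α) (c : α → ℕ) (k : ℕ) :
    (∑ s ∈ F, (X : ℚ[X]) ^ c s).coeff k = ((F.filter fun s => c s = k).card : ℚ) := by
  simp only [finsetSum_coeff, coeff_X_pow, card_filter, Nat.cast_sum, Nat.cast_ite, Nat.cast_one,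
    Nat.cast_zero, eq_comm]

/-! ### Rotating dissections -/

theorem mapChords_mul {n : ℕ} (g h : Equiv.Perm (Fin n)) (D : Finset (Sym2 (Fin n))) :
    mapChords g (mapChords h D) = mapChords (g * h) D := by
  ext e
  simp only [mem_mapChords, Equiv.Perm.coe_mul, exists_exists_and_eq_and, Sym2.map_map]

theorem mapChords_one {n : ℕ} (D : Finset (Sym2 (Fin n))) : mapChords 1 D = D := by
  ext e
  simp [mem_mapChords]

theorem card_mapChords {n : ℕ} (g : Equiv.Perm (Fin n)) (D : Finset (Sym2 (Fin n))) :
    (mapChords g D).card = D.card :=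
  card_image_of_injective _ (Sym2.map.injective g.injective)

theorem map_mem_mapChords {n : ℕ} {g : Equiv.Perm (Fin n)} {D : Finset (Sym2 (Fin n))} {e : Sym2 (Fin n)} :
    Sym2.map g e ∈ mapChords g D ↔ e ∈ D := by
  rw [mem_mapChords]
  constructor
  · rintro ⟨f, hf, h⟩
    rwa [← Sym2.map.injective g.injective h]
  · intro h
    exact ⟨e, h, rfl⟩

theorem IsDis.mapChords {n : ℕ} {g : Equiv.Perm (Fin n)} (hg : g ∈ Z n) {D : Finset (Sym2 (Fin n))}
    (h : IsDis D) : IsDis (mapChords g D) :=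
  (isDissection_mapChords hg (isDissection_iff.2 ⟨rfl, h⟩)).2

theorem sum_dissections_map {M : Type*} [AddCommMonoid M] {n : ℕ} {g : Equiv.Perm (Fin n)} (hg : g ∈ Z n)
    (f : Finset (Sym2 (Fin n)) → M) :
    ∑ D ∈ dissections n, f (mapChords g D) = ∑ D ∈ dissections n, f D := by
  refine sum_bij' (fun D _ => mapChords g D) (fun D _ => mapChords g⁻¹ D) ?_ ?_ ?_ ?_ ?_
  · intro D hD; exact mem_dissections.2 ((mem_dissections.1 hD).mapChords hg)
  · intro D hD; exact mem_dissections.2 ((mem_dissections.1 hD).mapChords (inv_mem hg))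
  · intro D _; rw [mapChords_mul, inv_mul_cancel, mapChords_one]
  · intro D _; rw [mapChords_mul, mul_inv_cancel, mapChords_one]
  · intros; rfl

theorem finRotate_mem {n : ℕ} : finRotate n ∈ Z n := Subgroup.mem_zpowers _

theorem card_chord_pairs {n : ℕ} {D : Finset (Sym2 (Fin n))} (hD : ∀ e ∈ D, ¬ e.IsDiag) :
    ∑ x : Fin n, ∑ y : Fin n, (if s(x, y) ∈ D then 1 else 0) = 2 * D.card := by
  classical
  have hfib := card_eq_sum_card_fiberwise (f := fun p : Fin n × Fin n => s(p.1, p.2))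
    (s := univ.filter fun p : Fin n × Fin n => s(p.1, p.2) ∈ D) (t := D)
    (fun p hp => (mem_filter.1 hp).2)
  rw [← sum_product', ← card_filter, univ_product_univ, hfib, mul_comm, ← smul_eq_mul, ← sum_const]
  refine sum_congr rfl fun e he => ?_
  induction e using Sym2.ind with
  | _ x y =>
    have hxy := hD _ he
    rw [Sym2.mk_isDiag_iff] at hxy
    have : ((univ.filter fun p : Fin n × Fin n => s(p.1, p.2) ∈ D).filter
        fun p => s(p.1, p.2) = s(x, y)) = {(x, y), (y, x)} := by
      ext ⟨p, q⟩
      simp only [mem_filter, mem_univ, true_and, mem_insert, mem_singleton, Prod.mk.injEq,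
        Sym2.eq_iff]
      constructor
      · exact fun h => h.2
      · rintro (⟨rfl, rfl⟩ | ⟨rfl, rfl⟩)
        · exact ⟨he, Or.inl ⟨rfl, rfl⟩⟩
        · rw [Sym2.eq_swap]
          exact ⟨he, Or.inr ⟨rfl, rfl⟩⟩
    rw [this, card_pair]
    rintro h
    exact hxy (Prod.ext_iff.1 h).1

section Count

variable {n : ℕ} [NeZero n]

/-- Glue along the side `{0, n - 1}`: it is never a diagonal and is crossed by none, so the
conditions of `sum_glue` are vacuous, and the other factor is `properGf 1 = 1`. -/
theorem sum_dissections (hn : 2 ≤ n) :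
    ∑ D ∈ dissections n, (X : ℚ[X]) ^ D.card = properGf (n - 1) := by
  classical
  have h := sum_glue (n := n) (b := n - 1) (by omega) (by omega)
  rw [sub_sub_cancel, properGf_one, mul_one] at h
  rw [← h, filter_true_of_mem]
  intro D hD
  rw [mem_dissections] at hD
  refine ⟨fun hs => ?_, fun e he hc => ?_⟩
  · have := (isDiagonal_vtx (by omega) (by omega)).1 (hD.1 _ hs)
    omega
  · obtain ⟨a, b, ha, hab, hb, rfl⟩ := exists_chord (hD.1 e he).1
    have := hc.interlace ha hab hb.le le_rfl (by omega) (by omega)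
    omega

theorem card_G (hn : 2 ≤ n) (k : ℕ) : (Nat.card (G n k) : ℚ) = (properGf (n - 1)).coeff k := by
  classical
  rw [← sum_dissections hn, coeff_sum_X_pow, G]
  congr 1
  refine Nat.subtype_card _ fun D => ?_
  rw [mem_filter, mem_dissections, isDissection_iff, and_comm]

theorem sum_univ_vtx {M : Type*} [AddCommMonoid M] (f : Fin n → M) :
    ∑ x, f x = ∑ b ∈ Ico 0 (n : ℤ), f (vtx n b) := by
  symm
  refine sum_bij (fun b _ => vtx n b) (fun _ _ => mem_univ _) ?_ ?_ ?_
  · intro a ha b hb h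
    rw [mem_Ico] at ha hb
    have e1 := coe_vtx_of_lt ha.1 ha.2
    have e2 := coe_vtx_of_lt hb.1 hb.2
    rw [h] at e1
    omega
  · intro x _
    obtain ⟨a, h0, h1, rfl⟩ := exists_vtx x
    exact ⟨a, mem_Ico.2 ⟨h0, h1⟩, rfl⟩
  · intros; rfl

/-- A function on vertices which is invariant under the rotation is constant. -/
theorem eq_of_finRotate_invariant {M : Type*} (h : Fin n → M)
    (hrot : ∀ x, h (finRotate n x) = h x) (x : Fin n) : h x = h (vtx n 0) := by
  obtain ⟨a, h0, -, rfl⟩ := exists_vtx x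
  obtain ⟨i, rfl⟩ := Int.eq_ofNat_of_zero_le h0
  induction i with
  | zero => rfl
  | succ i ih =>
    have := hrot (vtx n i)
    rw [finRotate_vtx] at this
    push_cast
    rw [this]
    exact ih (by positivity)

open scoped Classical in
/-- Dissections containing a given diagonal. -/
theorem sum_dissections_chord {b : ℤ} (hb : 2 ≤ b) (hbn : b + 2 ≤ n) :
    ∑ D ∈ dissections n with s(vtx n 0, vtx n b) ∈ D, (X : ℚ[X]) ^ D.card
      = X * (properGf b * properGf (n - b)) := by
  rw [← sum_glue (n := n) (b := b) (by omega) (by omega), mul_sum]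
  have hself : ∀ e : Sym2 (Fin n), ¬ Crosses e e := by
    intro e he
    obtain ⟨a, c, b, d, h0, h1, h2, h3, h4, ⟨rfl, h5⟩ | ⟨rfl, h5⟩⟩ := he.exists_vtx
    · have := chord_eq_cases (by omega) (by omega) (by omega) (by omega) (by omega) (by omega) h5
      omega
    · have := chord_eq_cases (by omega) (by omega) (by omega) (by omega) (by omega) (by omega) h5
      omega
  refine sum_bij' (fun D _ => D.erase s(vtx n 0, vtx n b))
    (fun D _ => insert s(vtx n 0, vtx n b) D) ?_ ?_ ?_ ?_ ?_
  · intro D hD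
    rw [mem_filter, mem_dissections] at hD ⊢
    refine ⟨⟨fun e he => hD.1.1 e (mem_of_mem_erase he), fun e he f hf =>
      hD.1.2 e (mem_of_mem_erase he) f (mem_of_mem_erase hf)⟩, notMem_erase _ _, fun e he =>
      hD.1.2 e (mem_of_mem_erase he) _ hD.2⟩
  · intro D hD
    rw [mem_filter, mem_dissections] at hD ⊢
    refine ⟨⟨fun e he => ?_, fun e he f hf => ?_⟩, mem_insert_self _ _⟩
    · rcases mem_insert.1 he with rfl | he
      · rw [isDiagonal_vtx (by omega) (by omega)]; omega
      · exact hD.1.1 e he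
    · rcases mem_insert.1 he with rfl | he <;> rcases mem_insert.1 hf with rfl | hf
      · exact hself _
      · exact fun h => hD.2.2 f hf h.symm
      · exact hD.2.2 e he
      · exact hD.1.2 e he f hf
  · intro D hD
    exact insert_erase (mem_filter.1 hD).2
  · intro D hD
    exact erase_insert (mem_filter.1 hD).2.1
  · intro D hD
    rw [← card_erase_add_one (mem_filter.1 hD).2, pow_succ']

/-- Double counting of the pairs of a dissection and one of its oriented diagonals. -/
theorem sum_card_dissections :
    ∑ D ∈ dissections n, ((2 * D.card : ℕ) : ℚ[X]) * (X : ℚ[X]) ^ D.card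
      = n * ∑ b ∈ Icc 2 ((n : ℤ) - 2), X * (properGf b * properGf (n - b)) := by
  classical
  -- `h x` collects the diagonals starting at `x` over all dissections. Rotation makes it constant,
  -- so the total is `n` times its value at `0`.
  set h : Fin n → ℚ[X] := fun x => ∑ y : Fin n, ∑ D ∈ dissections n,
    (if s(x, y) ∈ D then X ^ D.card else 0) with hh
  have hrot : ∀ x, h (finRotate n x) = h x := by
    intro x
    rw [hh]
    dsimp only
    rw [← Equiv.sum_comp (finRotate n)]
    refine sum_congr rfl fun y _ => ?_
    rw [← sum_dissections_map (finRotate_mem (n := n))]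
    refine sum_congr rfl fun D _ => ?_
    rw [card_mapChords]
    exact if_congr (map_mem_mapChords (e := s(x, y))) rfl rfl
  have h1 : ∑ D ∈ dissections n, ((2 * D.card : ℕ) : ℚ[X]) * (X : ℚ[X]) ^ D.card = ∑ x, h x := by
    rw [hh]
    dsimp only
    have : ∀ x : Fin n, ∑ y : Fin n, ∑ D ∈ dissections n,
        (if s(x, y) ∈ D then (X : ℚ[X]) ^ D.card else 0) = ∑ D ∈ dissections n, ∑ y : Fin n,
        (if s(x, y) ∈ D then (X : ℚ[X]) ^ D.card else 0) := fun x => sum_comm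
    simp_rw [this]
    rw [sum_comm]
    refine sum_congr rfl fun D hD => ?_
    rw [← card_chord_pairs fun e he => ((mem_dissections.1 hD).1 e he).1]
    push_cast
    rw [sum_mul]
    refine sum_congr rfl fun x _ => ?_
    rw [sum_mul]
    refine sum_congr rfl fun y _ => ?_
    rw [ite_mul, one_mul, zero_mul]
  rw [h1, sum_congr rfl fun x _ => eq_of_finRotate_invariant h hrot x, sum_const, card_univ,
    Fintype.card_fin, nsmul_eq_mul, hh]
  dsimp only
  rw [sum_univ_vtx]
  congr 1
  symm
  rw [sum_congr rfl fun b hb => (sum_dissections_chord (n := n) (b := b)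
    (by rw [mem_Icc] at hb; omega) (by rw [mem_Icc] at hb; omega)).symm]
  simp_rw [sum_filter]
  refine sum_subset ?_ ?_
  · intro b hb
    rw [mem_Icc] at hb
    rw [mem_Ico]
    omega
  · intro b hb hb'
    rw [mem_Ico] at hb
    rw [mem_Icc] at hb'
    refine sum_eq_zero fun D hD => ?_
    rw [if_neg]
    intro hs
    have hdiag := (mem_dissections.1 hD).1 _ hs
    rcases eq_or_lt_of_le hb.1 with rfl | h0
    · exact hdiag.1 (by simp)
    · rw [isDiagonal_vtx h0 (by omega)] at hdiag
      omega

theorem two_mul_coeff_properGf (hn : 2 ≤ n) (k : ℕ) :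
    2 * k * (properGf (n - 1)).coeff k
      = n * (X * ∑ b ∈ Icc 2 ((n : ℤ) - 2), (properGf b * properGf (n - b))).coeff k := by
  classical
  have h := congrArg (fun p => Polynomial.coeff p k) (sum_card_dissections (n := n))
  rw [← mul_sum, ← C_eq_natCast, coeff_C_mul] at h
  rw [← h, ← sum_dissections (by omega), finsetSum_coeff, finsetSum_coeff, mul_sum]
  refine sum_congr rfl fun D _ => ?_
  rw [← C_eq_natCast, coeff_C_mul, coeff_X_pow]
  split_ifs with h
  · subst h; push_cast; ring
  · simp

/-- The arc sets on `[0, n]` with a single break. -/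
theorem coeff_gf_one (hn : 3 ≤ n) (k : ℕ) :
    (n : ℚ) * (gf 0 n 1).coeff (k + 1) = 2 * (n + k) * (properGf (n - 1)).coeff k := by
  -- A break at `1` or `n - 1` leaves one unit piece and hence one full arc; any other break leaves
  -- two full arcs. The latter terms form the convolution evaluated by `two_mul_coeff_properGf`.
  have h1 : gf 0 n 1 = X * (2 * properGf (n - 1) +
      X * ∑ b ∈ Icc 2 ((n : ℤ) - 2), (properGf b * properGf (n - b))) := by
    have hI : Ioo 0 (n : ℤ) = insert 1 (insert ((n : ℤ) - 1) (Icc 2 ((n : ℤ) - 2))) := by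
      ext z
      simp only [mem_Ioo, mem_insert, mem_Icc]
      omega
    rw [gf_succ, hI, sum_insert (by simp only [mem_insert, mem_Icc]; omega),
      sum_insert (by simp only [mem_Icc]; omega), gf_one_zero, sub_sub_cancel, gf_one_zero,
      gf_zero_of_two_le (by omega), mul_add, mul_sum, mul_sum]
    have : ∀ b ∈ Icc 2 ((n : ℤ) - 2), gf 0 b 0 * gf 0 (n - b) 0
        = X * (X * (properGf b * properGf (n - b))) := by
      intro b hb
      rw [mem_Icc] at hb
      rw [gf_zero_of_two_le (by omega), gf_zero_of_two_le (by omega)]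
      ring
    rw [sum_congr rfl this]
    ring
  rw [h1, coeff_X_mul, coeff_add, mul_add, ← two_mul_coeff_properGf (by omega)]
  have : (2 : ℚ[X]) = C 2 := rfl
  rw [this, coeff_C_mul]
  ring

end Count

/-! ### The numbers `A` -/

/-- A proper arc set on `[0, p]` has at most `p - 2` arcs. The condition `h'` removes only `p = 1`,
`j = 0`, where the empty set is counted. -/
theorem coeff_properGf_eq_zero {p : ℕ} {j : ℕ} (hp : 1 ≤ p) (h : (p : ℤ) - 2 < j) (h' : 1 ≤ j ∨ 2 ≤ p) :
    (properGf p).coeff j = 0 := by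
  classical
  rw [properGf, coeff_sum_X_pow, Nat.cast_eq_zero, card_eq_zero, filter_eq_empty_iff]
  intro S hS hc
  rw [mem_properSets] at hS
  have := (card_le_of_mem_arcSets (p - 1) (by omega) hS.1).2 hS.2
  omega

/-- The convention `A 2 0 = 1` matches the empty arc set on a unit interval; for `j` beyond the
range of dissections both sides vanish by the size bound. -/
theorem A_eq_coeff {p : ℕ} (hp : 1 ≤ p) (j : ℕ) : A ((p : ℚ) + 1) j = (properGf p).coeff j := by
  classical
  unfold A
  rcases hp.eq_or_lt with rfl | hp
  · have e1 : ((1 : ℕ) : ℤ) = 1 := rfl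
    rw [e1, properGf_one, coeff_one]
    by_cases hj : j = 0
    · subst hj; norm_num
    · rw [if_neg, if_neg, if_neg hj]
      · rintro ⟨-, -, h, -⟩; norm_num at h
      · rintro ⟨-, h⟩; exact hj (by exact_mod_cast h)
  · have e1 : ((p : ℚ) + 1) = ((p + 1 : ℕ) : ℚ) := by push_cast; rfl
    rw [if_neg (by rintro ⟨h, -⟩; rw [e1] at h; have : p + 1 = 2 := by exact_mod_cast h
                   omega)]
    by_cases hj : j ≤ p - 2
    · rw [if_pos]
      · have : NeZero (p + 1) := ⟨by omega⟩
        rw [e1, Rat.num_natCast, Rat.num_natCast, Int.toNat_natCast, Int.toNat_natCast,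
          card_G (by omega)]
        push_cast
        rw [add_sub_cancel_right]
      · refine ⟨by rw [e1]; rfl, rfl, ?_, by positivity, ?_⟩
        · rw [e1]; exact_mod_cast (by omega : 3 ≤ p + 1)
        · have : (j : ℚ) + 2 ≤ p := by exact_mod_cast (by omega : j + 2 ≤ p)
          linarith
    · rw [if_neg, coeff_properGf_eq_zero (by omega) (by omega) (by omega)]
      rintro ⟨-, -, -, -, h⟩
      apply hj
      have : (j : ℚ) + 2 ≤ p := by linarith
      have : j + 2 ≤ p := by exact_mod_cast this
      omega

/-- Serves to read off divisibility: a nonzero `A` at fractional expressions in `n / d` and `k / d`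
forces these to be integers. -/
theorem exists_of_A_ne_zero {x y : ℚ} (h : A x y ≠ 0) :
    ∃ p j : ℕ, 1 ≤ p ∧ x = p + 1 ∧ y = j := by
  classical
  unfold A at h
  split_ifs at h with h1 h2
  · exact ⟨1, 0, le_rfl, by rw [h1.1]; norm_num, by rw [h1.2]; norm_num⟩
  · obtain ⟨hx, hy, h3, h4, -⟩ := h2
    have ex : ((x.num : ℤ) : ℚ) = x := Rat.coe_int_num_of_den_eq_one (by simpa [Rat.isInt] using hx)
    have ey : ((y.num : ℤ) : ℚ) = y := Rat.coe_int_num_of_den_eq_one (by simpa [Rat.isInt] using hy)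
    have h5 : 3 ≤ x.num := by rw [← ex] at h3; exact_mod_cast h3
    have h6 : 0 ≤ y.num := by rw [← ey] at h4; exact_mod_cast h4
    refine ⟨(x.num - 1).toNat, y.num.toNat, by omega, ?_, ?_⟩
    · have : (((x.num - 1).toNat : ℤ) : ℚ) = ((x.num - 1 : ℤ) : ℚ) := by
        rw [Int.toNat_of_nonneg (by omega)]
      rw [← Int.cast_natCast, this]
      push_cast
      rw [ex]; ring
    · have : ((y.num.toNat : ℤ) : ℚ) = ((y.num : ℤ) : ℚ) := by
        rw [Int.toNat_of_nonneg (by omega)]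
      rw [← Int.cast_natCast, this, ey]
  · exact absurd rfl h

/-! ### Dissections fixed by a rotation -/

open scoped Classical in
/-- The dissections of the `n`-gon which are fixed by the rotation `v ↦ v + m`. -/
def fixedDissections (n m : ℕ) : Finset (Finset (Sym2 (Fin n))) :=
  {D ∈ dissections n | mapChords (finRotate n ^ m) D = D}

theorem mem_fixedDissections {n m : ℕ} {D : Finset (Sym2 (Fin n))} :
    D ∈ fixedDissections n m ↔ IsDis D ∧ mapChords (finRotate n ^ m) D = D := by
  classical
  rw [fixedDissections, mem_filter, mem_dissections]

theorem rotate_mem_fixedDissections {n m : ℕ} {D : Finset (Sym2 (Fin n))} {g : Equiv.Perm (Fin n)}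
    (hg : g ∈ Z n) (hD : D ∈ fixedDissections n m) : mapChords g D ∈ fixedDissections n m := by
  rw [mem_fixedDissections] at hD ⊢
  refine ⟨hD.1.mapChords hg, ?_⟩
  obtain ⟨i, rfl⟩ := hg
  have hcomm : finRotate n ^ m * finRotate n ^ i = finRotate n ^ i * finRotate n ^ m :=
    ((Commute.refl (finRotate n)).pow_left m).zpow_right i
  rw [mapChords_mul, hcomm, ← mapChords_mul, hD.2]

section Fixed

variable {n : ℕ} [NeZero n] {d m : ℕ}

theorem mem_add_of_fixed {D : Finset (Sym2 (Fin n))} (hD : mapChords (finRotate n ^ m) D = D)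
    (a b : ℤ) : s(vtx n (a + m), vtx n (b + m)) ∈ D ↔ s(vtx n a, vtx n b) ∈ D := by
  have h := map_mem_mapChords (g := finRotate n ^ m) (D := D) (e := s(vtx n a, vtx n b))
  rw [hD, Sym2.map_mk, finRotate_pow_vtx, finRotate_pow_vtx] at h
  exact h

theorem mem_add_mul_of_fixed {D : Finset (Sym2 (Fin n))} (hD : mapChords (finRotate n ^ m) D = D)
    (a b i : ℤ) : s(vtx n (a + i * m), vtx n (b + i * m)) ∈ D ↔ s(vtx n a, vtx n b) ∈ D := by
  induction i using Int.induction_on with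
  | zero => simp
  | succ i ih =>
    rw [← ih, add_mul, one_mul, ← add_assoc, ← add_assoc]
    exact mem_add_of_fixed hD _ _
  | pred i ih =>
    rw [← ih, ← mem_add_of_fixed hD]
    have : ∀ x : ℤ, x + (-(i : ℤ) - 1) * m + m = x + -(i : ℤ) * m := fun x => by ring
    rw [this, this]

/-- A diagonal of a fixed dissection is cut off by an arc of length at most `m`. -/
theorem exists_short_arc (hn : n = d * m) {D : Finset (Sym2 (Fin n))}
    (hD : D ∈ fixedDissections n m) {f : Sym2 (Fin n)} (hf : f ∈ D) :
    ∃ a b : ℤ, a < b ∧ b ≤ a + m ∧ f = s(vtx n a, vtx n b) := by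
  rw [mem_fixedDissections] at hD
  obtain ⟨a, b, ha, hab, hb, rfl⟩ := exists_chord (hD.1.1 f hf).1
  have hm : 0 < m := by
    rcases Nat.eq_zero_or_pos m with rfl | h
    · exact absurd hn (NeZero.ne n)
    · exact h
  by_cases h1 : b ≤ a + m
  · exact ⟨a, b, hab, h1, rfl⟩
  by_cases h2 : n ≤ b - a + m
  · exact ⟨b, a + n, by omega, by omega, by rw [vtx_add_self, Sym2.eq_swap]⟩
  -- For lengths strictly between `m` and `n - m`, `a < a + m < b < b + m < a + n`, so the chord
  -- crosses its rotation by `m`.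
  · exfalso
    refine hD.1.2 _ hf _ ((mem_add_of_fixed hD.2 a b).2 hf) (crosses_vtx ?_ ?_ ?_ ?_) <;> omega

/-- The label `z` is central for `D` if no chord of `D` cuts it off by an arc of length at
most `m`: these are the vertices of the central cell. -/
def IsCentral (D : Finset (Sym2 (Fin n))) (m : ℕ) (z : ℤ) : Prop :=
  ∀ a b : ℤ, a < z → z < b → b ≤ a + m → s(vtx n a, vtx n b) ∉ D

theorem isCentral_add {D : Finset (Sym2 (Fin n))} (hD : mapChords (finRotate n ^ m) D = D)
    (i z : ℤ) : IsCentral D m (z + i * m) ↔ IsCentral D m z := by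
  constructor
  · intro h a b h1 h2 h3 h4
    exact h (a + i * m) (b + i * m) (by omega) (by omega) (by omega)
      ((mem_add_mul_of_fixed hD _ _ _).2 h4)
  · intro h a b h1 h2 h3 h4
    refine h (a - i * m) (b - i * m) (by omega) (by omega) (by omega) ?_
    rw [← mem_add_mul_of_fixed hD _ _ i]
    simpa using h4

theorem isCentral_rotate (D : Finset (Sym2 (Fin n))) (z : ℤ) :
    IsCentral (mapChords (finRotate n) D) m (z + 1) ↔ IsCentral D m z := by
  have key : ∀ a b : ℤ, s(vtx n (a + 1), vtx n (b + 1)) ∈ mapChords (finRotate n) D ↔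
      s(vtx n a, vtx n b) ∈ D := by
    intro a b
    have h := map_mem_mapChords (g := finRotate n) (D := D) (e := s(vtx n a, vtx n b))
    rwa [Sym2.map_mk, finRotate_vtx, finRotate_vtx] at h
  constructor
  · intro h a b h1 h2 h3 h4
    exact h (a + 1) (b + 1) (by omega) (by omega) (by omega) ((key _ _).2 h4)
  · intro h a b h1 h2 h3 h4
    refine h (a - 1) (b - 1) (by omega) (by omega) (by omega) ?_
    rw [← key]
    simpa using h4

open scoped Classical in
/-- The number of central labels modulo `m`. -/
def numCentral (D : Finset (Sym2 (Fin n))) (m : ℕ) : ℕ := ((Ico 0 (m : ℤ)).filter (IsCentral D m)).card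

theorem numCentral_le (D : Finset (Sym2 (Fin n))) : numCentral D m ≤ m := by
  classical
  refine (card_filter_le _ _).trans ?_
  simp

/-- Take the longest arc of length at most `m` given by a chord of `D`. An arc covering its right
end is no longer than it, so it starts strictly inside and the two chords cross. If `D` gives no
such arc, every label is central. -/
theorem exists_isCentral (hd : 2 ≤ d) (hn : n = d * m) {D : Finset (Sym2 (Fin n))}
    (hD : D ∈ fixedDissections n m) : ∃ z, IsCentral D m z := by
  classical
  by_contra hcon
  push Not at hcon
  set T := (Icc 1 m).filter fun ℓ : ℕ => ∃ a : ℤ, s(vtx n a, vtx n (a + ℓ)) ∈ D with hT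
  have hmemT : ∀ a b : ℤ, a < b → b ≤ a + m → s(vtx n a, vtx n b) ∈ D → (b - a).toNat ∈ T := by
    intro a b h1 h2 h3
    rw [hT, mem_filter, mem_Icc]
    refine ⟨by omega, a, ?_⟩
    rwa [show a + ((b - a).toNat : ℤ) = b by omega]
  have hTne : T.Nonempty := by
    have h0 := hcon 0
    unfold IsCentral at h0
    push Not at h0
    obtain ⟨a, b, h1, h2, h3, h4⟩ := h0
    exact ⟨_, hmemT a b (by omega) h3 h4⟩
  obtain ⟨ℓ, hℓ, hmax⟩ := exists_max_image T id hTne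
  rw [hT, mem_filter, mem_Icc] at hℓ
  obtain ⟨hℓ, a, ha⟩ := hℓ
  have h0 := hcon (a + ℓ)
  unfold IsCentral at h0
  push Not at h0
  obtain ⟨c, e, h1, h2, h3, h4⟩ := h0
  have h5 := hmax _ (hmemT c e (by omega) h3 h4)
  dsimp only [id] at h5
  have h2m : 2 * m ≤ n := by rw [hn]; exact Nat.mul_le_mul_right m hd
  rw [mem_fixedDissections] at hD
  exact hD.1.2 _ ha _ h4 (crosses_vtx (by omega) (by omega) (by omega) (by omega))

theorem numCentral_pos (hd : 2 ≤ d) (hn : n = d * m) {D : Finset (Sym2 (Fin n))}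
    (hD : D ∈ fixedDissections n m) : 0 < numCentral D m := by
  classical
  obtain ⟨z, hz⟩ := exists_isCentral hd hn hD
  have hm : 0 < m := by
    rcases Nat.eq_zero_or_pos m with rfl | h
    · exact absurd hn (NeZero.ne n)
    · exact h
  refine card_pos.2 ⟨z % m, mem_filter.2 ⟨mem_Ico.2 ⟨Int.emod_nonneg _ (by omega),
    Int.emod_lt_of_pos _ (by omega)⟩, ?_⟩⟩
  rw [← isCentral_add (mem_fixedDissections.1 hD).2 (z / m)]
  have : z % m + z / m * m = z := by rw [mul_comm]; exact Int.emod_add_mul_ediv z m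
  rwa [this]

theorem numCentral_rotate {D : Finset (Sym2 (Fin n))} (hD : mapChords (finRotate n ^ m) D = D) :
    numCentral (mapChords (finRotate n) D) m = numCentral D m := by
  classical
  unfold numCentral
  symm
  have hper : IsCentral D m ((m : ℤ) - 1) ↔ IsCentral D m (-1) := by
    have := isCentral_add hD 1 (-1)
    rwa [one_mul, neg_add_eq_sub] at this
  refine card_bij' (fun z _ => if z = m - 1 then 0 else z + 1)
    (fun z _ => if z = 0 then (m : ℤ) - 1 else z - 1) ?_ ?_ ?_ ?_
  · intro z hz
    rw [mem_filter, mem_Ico] at hz ⊢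
    split_ifs with h
    · refine ⟨by omega, ?_⟩
      rw [h, hper, ← isCentral_rotate] at hz
      exact hz.2
    · exact ⟨by omega, (isCentral_rotate _ _).2 hz.2⟩
  · intro z hz
    rw [mem_filter, mem_Ico] at hz ⊢
    split_ifs with h
    · refine ⟨by omega, ?_⟩
      rw [hper, ← isCentral_rotate]
      rw [h] at hz
      exact hz.2
    · refine ⟨by omega, ?_⟩
      rw [← isCentral_rotate, sub_add_cancel]
      exact hz.2
  · intro z hz
    rw [mem_filter, mem_Ico] at hz
    split_ifs <;> omega
  · intro z hz
    rw [mem_filter, mem_Ico] at hz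
    split_ifs <;> omega

open scoped Classical in
/-- Counting pairs of a fixed dissection and one of its central labels. -/
theorem numCentral_mul_card (r k : ℕ) :
    r * ((fixedDissections n m).filter fun D => D.card = k ∧ numCentral D m = r).card
      = m * ((fixedDissections n m).filter fun D =>
          IsCentral D m 0 ∧ D.card = k ∧ numCentral D m = r).card := by
  set N : ℤ → ℕ := fun z => ((fixedDissections n m).filter fun D =>
          IsCentral D m z ∧ D.card = k ∧ numCentral D m = r).card with hN
  -- Rotation by one step carries dissections with `z` central to those with `z + 1` central and
  -- preserves both statistics.
  have hstep : ∀ z, N (z + 1) = N z := by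
    intro z
    rw [hN]
    symm
    refine card_bij' (fun D _ => mapChords (finRotate n) D)
      (fun D _ => mapChords (finRotate n)⁻¹ D) ?_ ?_ ?_ ?_
    · intro D hD
      rw [mem_filter] at hD ⊢
      refine ⟨rotate_mem_fixedDissections finRotate_mem hD.1, (isCentral_rotate _ _).2 hD.2.1, ?_⟩
      rw [card_mapChords, numCentral_rotate (mem_fixedDissections.1 hD.1).2]
      exact hD.2.2
    · intro D hD
      rw [mem_filter] at hD ⊢
      have h1 := rotate_mem_fixedDissections (inv_mem finRotate_mem) hD.1
      have h2 : mapChords (finRotate n) (mapChords (finRotate n)⁻¹ D) = D := by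
        rw [mapChords_mul, mul_inv_cancel, mapChords_one]
      refine ⟨h1, ?_, ?_⟩
      · rw [← isCentral_rotate, h2]; exact hD.2.1
      · rw [card_mapChords, ← numCentral_rotate (mem_fixedDissections.1 h1).2, h2]
        exact hD.2.2
    · intro D _; rw [mapChords_mul, inv_mul_cancel, mapChords_one]
    · intro D _; rw [mapChords_mul, mul_inv_cancel, mapChords_one]
  have hconst : ∀ z ∈ Ico 0 (m : ℤ), N z = N 0 := by
    intro z hz
    obtain ⟨i, rfl⟩ := Int.eq_ofNat_of_zero_le (mem_Ico.1 hz).1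
    clear hz
    induction i with
    | zero => rfl
    | succ i ih => push_cast; rw [hstep]; exact ih
  have h1 : ∑ z ∈ Ico 0 (m : ℤ), N z = m * N 0 := by
    rw [sum_congr rfl hconst, sum_const]
    simp
  rw [← h1, hN]
  simp_rw [card_filter _ (fixedDissections n m)]
  rw [sum_comm, mul_sum]
  refine sum_congr rfl fun D hD => ?_
  split_ifs with h
  · rw [mul_one]
    calc r = ∑ z ∈ Ico 0 (m : ℤ), if IsCentral D m z then 1 else 0 := by
            rw [← card_filter]; exact h.2.symm
      _ = _ := sum_congr rfl fun z _ => if_congr (and_iff_left h).symm rfl rfl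
  · rw [mul_zero]
    symm
    refine sum_eq_zero fun z _ => if_neg fun h' => h h'.2

/-! ### Fixed dissections and arc sets -/

/-- The chords obtained from a set of arcs on `[0, m]` by all rotations by multiples of `m`. -/
def spread (n d m : ℕ) [NeZero n] (S : Finset (ℤ × ℤ)) : Finset (Sym2 (Fin n)) :=
  (S ×ˢ Ico 0 (d : ℤ)).image fun p => s(vtx n (p.1.1 + p.2 * m), vtx n (p.1.2 + p.2 * m))

theorem mem_spread_iff {S : Finset (ℤ × ℤ)} {f : Sym2 (Fin n)} :
    f ∈ spread n d m S ↔ ∃ e ∈ S, ∃ i : ℤ, (0 ≤ i ∧ i < d) ∧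
      s(vtx n (e.1 + i * m), vtx n (e.2 + i * m)) = f := by
  rw [spread, mem_image]
  constructor
  · rintro ⟨⟨e, i⟩, h, rfl⟩
    rw [mem_product, mem_Ico] at h
    exact ⟨e, h.1, i, h.2, rfl⟩
  · rintro ⟨e, he, i, hi, rfl⟩
    exact ⟨(e, i), mem_product.2 ⟨he, mem_Ico.2 hi⟩, rfl⟩

theorem mem_spread (hd : 0 < d) (hn : n = d * m) {S : Finset (ℤ × ℤ)} {e : ℤ × ℤ} (he : e ∈ S)
    (i : ℤ) : s(vtx n (e.1 + i * m), vtx n (e.2 + i * m)) ∈ spread n d m S := by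
  rw [mem_spread_iff]
  refine ⟨e, he, i % d, ⟨Int.emod_nonneg _ (by omega), Int.emod_lt_of_pos _ (by omega)⟩, ?_⟩
  have key : ∀ x : ℤ, vtx n (x + i % d * m) = vtx n (x + i * m) := by
    intro x
    rw [← vtx_add_mul (x + i % d * m) (i / d)]
    congr 1
    have : i % d + d * (i / d) = i := Int.emod_add_mul_ediv i d
    rw [hn]
    push_cast
    linear_combination (m : ℤ) * this
  rw [key, key]

/-- Each translated arc stays in one block `[i m, (i + 1) m]` of the window `[0, n]`. The
exceptional coincidence `(0, c)`, `(c, n)` needs two blocks to fill the window, so `d = 2` and both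
arcs are full: they give the same diameter. -/
theorem spread_chord_eq (hd : 2 ≤ d) (hn : n = d * m) {e f : ℤ × ℤ} {i j : ℤ}
    (he : 0 ≤ e.1 ∧ e.1 + 2 ≤ e.2 ∧ e.2 ≤ m) (hf : 0 ≤ f.1 ∧ f.1 + 2 ≤ f.2 ∧ f.2 ≤ m)
    (hi : 0 ≤ i ∧ i < d) (hj : 0 ≤ j ∧ j < d)
    (h : s(vtx n (e.1 + i * m), vtx n (e.2 + i * m)) = s(vtx n (f.1 + j * m), vtx n (f.2 + j * m))) :
    (e = f ∧ i = j) ∨ (d = 2 ∧ e = (0, (m : ℤ)) ∧ f = (0, (m : ℤ))) := by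
  have hm : (0 : ℤ) ≤ m := by positivity
  have step : ∀ x y : ℤ, x < y → x * m + m ≤ y * m := by
    intro x y hxy
    have := mul_le_mul_of_nonneg_right (show x + 1 ≤ y by omega) hm
    rwa [add_mul, one_mul] at this
  have hnz : (n : ℤ) = d * m := by rw [hn]; push_cast; rfl
  have h2m : 2 * m ≤ n := by rw [hn]; exact Nat.mul_le_mul_right m hd
  have i0 : 0 ≤ i * m := mul_nonneg hi.1 hm
  have j0 : 0 ≤ j * m := mul_nonneg hj.1 hm
  have i1 := step _ _ hi.2
  have j1 := step _ _ hj.2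
  have hij : i * (m : ℤ) = j * m → i = j := by
    intro hij
    rcases lt_trichotomy i j with h | h | h
    · have := step _ _ h; omega
    · exact h
    · have := step _ _ h; omega
  have hd2 : (d : ℤ) * m ≤ m + m → d = 2 := by
    intro h
    by_contra hne
    have h3 := step 2 d (by omega)
    omega
  rcases chord_eq_cases (by omega) (by omega) (by omega) (by omega) (by omega) (by omega) h with
    h | h | h
  · have : i * (m : ℤ) = j * m := by
      rcases lt_trichotomy i j with h' | h' | h'
      · have := step _ _ h'; omega
      · rw [h']
      · have := step _ _ h'; omega
    left
    exact ⟨Prod.ext (by omega) (by omega), hij this⟩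
  · right
    exact ⟨hd2 (by omega), Prod.ext (by dsimp only; omega) (by dsimp only; omega),
      Prod.ext (by dsimp only; omega) (by dsimp only; omega)⟩
  · right
    exact ⟨hd2 (by omega), Prod.ext (by dsimp only; omega) (by dsimp only; omega),
      Prod.ext (by dsimp only; omega) (by dsimp only; omega)⟩

theorem card_spread (hd : 2 ≤ d) (hn : n = d * m) {S : Finset (ℤ × ℤ)} (hS : S ∈ arcSets 0 m)
    (h : d = 2 → (0, (m : ℤ)) ∉ S) : (spread n d m S).card = d * S.card := by
  rw [mem_arcSets] at hS
  rw [spread, card_image_of_injOn, card_product, Int.card_Ico, sub_zero, Int.toNat_natCast, mul_comm]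
  rintro ⟨e, i⟩ he ⟨f, j⟩ hf hef
  rw [mem_coe, mem_product, mem_Ico] at he hf
  rcases spread_chord_eq hd hn (hS.1 e he.1) (hS.1 f hf.1) he.2 hf.2 hef with h' | h'
  · exact Prod.ext h'.1 h'.2
  · exact absurd (h'.2.1 ▸ he.1) (h h'.1)

/-- The two copies of the full arc are the two sides of one diameter, so one chord is lost; all
other arcs still have two distinct copies. -/
theorem card_spread_two (hn : n = 2 * m) {S : Finset (ℤ × ℤ)} (hS : S ∈ arcSets 0 m)
    (h : (0, (m : ℤ)) ∈ S) : (spread n 2 m S).card + 1 = 2 * S.card := by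
  classical
  have hm := (mem_arcSets.1 hS).1 _ h
  dsimp only at hm
  have h1 : spread n 2 m S = insert s(vtx n 0, vtx n m) (spread n 2 m (S.erase (0, (m : ℤ)))) := by
    ext f
    rw [mem_insert, mem_spread_iff, mem_spread_iff]
    constructor
    · rintro ⟨e, he, i, hi, rfl⟩
      by_cases h0 : e = (0, (m : ℤ))
      · subst h0
        left
        have : i = 0 ∨ i = 1 := by
          have := hi.2; push_cast at this; omega
        rcases this with rfl | rfl
        · simp
        · have : ((m : ℤ) + 1 * m) = 0 + n := by rw [hn]; push_cast; ring
          dsimp only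
          rw [this, vtx_add_self, Sym2.eq_swap]
          simp
      · exact Or.inr ⟨e, mem_erase.2 ⟨h0, he⟩, i, hi, rfl⟩
    · rintro (rfl | ⟨e, he, i, hi, rfl⟩)
      · exact ⟨_, h, 0, by simp, by simp⟩
      · exact ⟨e, mem_of_mem_erase he, i, hi, rfl⟩
  have h2 : s(vtx n 0, vtx n m) ∉ spread n 2 m (S.erase (0, (m : ℤ))) := by
    rw [mem_spread_iff]
    rintro ⟨e, he, i, hi, hs⟩
    have h3 : s(vtx n ((0, (m : ℤ)).1 + 0 * m), vtx n ((0, (m : ℤ)).2 + 0 * m)) =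
        s(vtx n 0, vtx n m) := by simp
    rw [← h3] at hs
    have he' := mem_erase.1 he
    rcases spread_chord_eq le_rfl hn ((mem_arcSets.1 hS).1 e he'.2) ((mem_arcSets.1 hS).1 _ h) hi
      (by norm_num) hs with h' | h'
    · exact he'.1 h'.1
    · exact he'.1 h'.2.1
  rw [h1, card_insert_of_notMem h2, card_spread le_rfl hn (subset_mem_arcSets hS (erase_subset _ _))
    (fun _ => notMem_erase _ _), ← card_erase_add_one h]
  omega

theorem spread_mem_fixedDissections (hd : 2 ≤ d) (hn : n = d * m) {S : Finset (ℤ × ℤ)}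
    (hS : S ∈ arcSets 0 m) : spread n d m S ∈ fixedDissections n m := by
  rw [mem_arcSets] at hS
  have hm : (0 : ℤ) ≤ m := by positivity
  have step : ∀ x y : ℤ, x < y → x * m + m ≤ y * m := by
    intro x y hxy
    have := mul_le_mul_of_nonneg_right (show x + 1 ≤ y by omega) hm
    rwa [add_mul, one_mul] at this
  have hnz : (n : ℤ) = d * m := by rw [hn]; push_cast; rfl
  have h2m : 2 * m ≤ n := by rw [hn]; exact Nat.mul_le_mul_right m hd
  rw [mem_fixedDissections]
  refine ⟨⟨fun f hf => ?_, fun f hf g hg hfg => ?_⟩, ?_⟩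
  · obtain ⟨e, he, i, hi, rfl⟩ := mem_spread_iff.1 hf
    have := hS.1 e he
    rw [isDiagonal_vtx (by omega) (by omega)]
    omega
  · obtain ⟨e, he, i, hi, rfl⟩ := mem_spread_iff.1 hf
    obtain ⟨f, hf, j, hj, rfl⟩ := mem_spread_iff.1 hg
    have h1 := hS.1 e he
    have h2 := hS.1 f hf
    have i0 : 0 ≤ i * m := mul_nonneg hi.1 hm
    have j0 : 0 ≤ j * m := mul_nonneg hj.1 hm
    have i1 := step _ _ hi.2
    have j1 := step _ _ hj.2
    have h3 := hfg.interlace (by omega) (by omega) (by omega) (by omega) (by omega) (by omega)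
    rcases lt_trichotomy i j with h | rfl | h
    · have := step _ _ h; omega
    · have h4 := hS.2 e he f hf
      have h5 := hS.2 f hf e he
      omega
    · have := step _ _ h; omega
  · refine eq_of_subset_of_card_le (fun f hf => ?_) (by rw [card_mapChords])
    obtain ⟨g, hg, rfl⟩ := mem_mapChords.1 hf
    obtain ⟨e, he, i, hi, rfl⟩ := mem_spread_iff.1 hg
    rw [Sym2.map_mk, finRotate_pow_vtx, finRotate_pow_vtx]
    have := mem_spread (by omega) hn he (i + 1)
    rwa [add_mul, one_mul, ← add_assoc, ← add_assoc] at this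

theorem isCentral_spread (hd : 2 ≤ d) (hn : n = d * m) {S : Finset (ℤ × ℤ)}
    (hS : S ∈ arcSets 0 m) : IsCentral (spread n d m S) m 0 := by
  rw [mem_arcSets] at hS
  have hm : (0 : ℤ) ≤ m := by positivity
  have step : ∀ x y : ℤ, x < y → x * m + m ≤ y * m := by
    intro x y hxy
    have := mul_le_mul_of_nonneg_right (show x + 1 ≤ y by omega) hm
    rwa [add_mul, one_mul] at this
  have hnz : (n : ℤ) = d * m := by rw [hn]; push_cast; rfl
  have h2m : 2 * m ≤ n := by rw [hn]; exact Nat.mul_le_mul_right m hd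
  intro a b ha hb hab hs
  obtain ⟨e, he, i, hi, h⟩ := mem_spread_iff.1 hs
  have h1 := hS.1 e he
  have i0 : 0 ≤ i * m := mul_nonneg hi.1 hm
  have i1 := step _ _ hi.2
  -- An arc passing over `0` becomes `(b, a + n)` in the window `[0, n]`, where it can be compared
  -- with the blocks.
  rw [← vtx_add_self a, Sym2.eq_swap (a := vtx n (a + n))] at h
  have := chord_eq_cases (by omega) (by omega) (by omega) (by omega) (by omega) (by omega) h
  rcases hi.1.eq_or_lt with rfl | hi0
  · omega
  · have := step _ _ hi0
    omega

theorem arcsIn_spread (hd : 2 ≤ d) (hn : n = d * m) {S : Finset (ℤ × ℤ)}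
    (hS : S ∈ arcSets 0 m) : arcsIn (spread n d m S) 0 m = S := by
  rw [mem_arcSets] at hS
  ext e
  rw [mem_arcsIn]
  constructor
  · rintro ⟨h1, h2⟩
    obtain ⟨f, hf, i, hi, h⟩ := mem_spread_iff.1 h2
    have h3 : s(vtx n (e.1 + 0 * m), vtx n (e.2 + 0 * m)) = s(vtx n e.1, vtx n e.2) := by simp
    rw [← h3] at h
    rcases spread_chord_eq hd hn (hS.1 f hf) h1 hi (by omega) h with h' | h'
    · rw [← h'.1]; exact hf
    · rw [h'.2.2, ← h'.2.1]; exact hf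
  · intro he
    refine ⟨hS.1 e he, ?_⟩
    have := mem_spread (n := n) (d := d) (m := m) (by omega) hn he 0
    simpa using this

/-- Move a short arc of a chord by a multiple of `m` so that it starts in `[0, m)`. As `m` is
central along with `0`, the arc cannot pass over `m`, hence lies in `[0, m]`. -/
theorem spread_arcsIn (hd : 2 ≤ d) (hn : n = d * m) {D : Finset (Sym2 (Fin n))}
    (hD : D ∈ fixedDissections n m) (h0 : IsCentral D m 0) : spread n d m (arcsIn D 0 m) = D := by
  have hD' := mem_fixedDissections.1 hD
  have hm : 0 < m := by
    rcases Nat.eq_zero_or_pos m with rfl | h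
    · exact absurd hn (NeZero.ne n)
    · exact h
  have h2m : 2 * m ≤ n := by rw [hn]; exact Nat.mul_le_mul_right m hd
  ext f
  constructor
  · intro hf
    obtain ⟨e, he, i, -, rfl⟩ := mem_spread_iff.1 hf
    rw [mem_add_mul_of_fixed hD'.2]
    exact (mem_arcsIn.1 he).2
  · intro hf
    obtain ⟨a, b, h1, h2, rfl⟩ := exists_short_arc hn hD hf
    have e1 : a % m + a / m * m = a := by rw [mul_comm]; exact Int.emod_add_mul_ediv a m
    have e2 := Int.emod_nonneg a (show (m : ℤ) ≠ 0 by omega)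
    have e3 := Int.emod_lt_of_pos a (show (0 : ℤ) < m by omega)
    set q := a / m with hq
    set c := a % m with hc
    have hb : b = (b - q * m) + q * m := by ring
    have hmem : s(vtx n c, vtx n (b - q * m)) ∈ D := by
      rw [← mem_add_mul_of_fixed hD'.2 _ _ q, e1, ← hb]
      exact hf
    have hle : b - q * m ≤ m := by
      by_contra hcon
      have hcm : IsCentral D m m := by
        have := isCentral_add hD'.2 1 0
        rw [one_mul, zero_add] at this
        exact this.2 h0
      exact hcm c (b - q * m) e3 (by omega) (by omega) hmem
    have hdiag := (isDiagonal_vtx (by omega) (by omega)).1 (hD'.1.1 _ hmem)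
    have := mem_spread (n := n) (d := d) (m := m) (by omega) hn
      (mem_arcsIn.2 ⟨⟨e2, hdiag.1, hle⟩, hmem⟩ : (c, b - q * m) ∈ arcsIn D 0 m) q
    dsimp only at this
    rwa [e1, ← hb] at this

/-- A short arc covering a point of `(0, m)` cannot pass over the central labels `0` and `m`, so
central labels there are exactly the breaks. The extra one is the label `0`. -/
theorem numCentral_eq (hd : 2 ≤ d) (hn : n = d * m) {D : Finset (Sym2 (Fin n))}
    (hD : D ∈ fixedDissections n m) (h0 : IsCentral D m 0) :
    numCentral D m = (breaks (arcsIn D 0 m) 0 m).card + 1 := by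
  classical
  have hD' := mem_fixedDissections.1 hD
  have hm : 0 < m := by
    rcases Nat.eq_zero_or_pos m with rfl | h
    · exact absurd hn (NeZero.ne n)
    · exact h
  have h2m : 2 * m ≤ n := by rw [hn]; exact Nat.mul_le_mul_right m hd
  have hcm : IsCentral D m m := by
    have := isCentral_add hD'.2 1 0
    rw [one_mul, zero_add] at this
    exact this.2 h0
  have : (Ico 0 (m : ℤ)).filter (IsCentral D m) = insert 0 (breaks (arcsIn D 0 m) 0 m) := by
    ext z
    rw [mem_filter, mem_Ico, mem_insert, mem_breaks]
    constructor
    · rintro ⟨h1, h2⟩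
      rcases h1.1.eq_or_lt with h | h
      · exact Or.inl h.symm
      · refine Or.inr ⟨⟨h, h1.2⟩, fun e he hz => ?_⟩
        rw [mem_arcsIn] at he
        exact h2 _ _ hz.1 hz.2 (by omega) he.2
    · rintro (rfl | ⟨h1, h2⟩)
      · exact ⟨⟨le_rfl, by omega⟩, h0⟩
      · refine ⟨⟨by omega, by omega⟩, fun a b ha hb hab hs => ?_⟩
        have hdiag := (isDiagonal_vtx (by omega) (by omega)).1 (hD'.1.1 _ hs)
        have ha0 : 0 ≤ a := by
          by_contra hcon
          exact h0 a b (by omega) (by omega) hab hs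
        have hbm : b ≤ m := by
          by_contra hcon
          exact hcm a b (by omega) (by omega) hab hs
        exact h2 (a, b) (mem_arcsIn.2 ⟨⟨ha0, hdiag.1, hbm⟩, hs⟩) ⟨ha, hb⟩
  rw [numCentral, this, card_insert_of_notMem]
  rw [mem_breaks]
  omega

open scoped Classical in
theorem card_central_zero (hd : 2 ≤ d) (hn : n = d * m) (s k : ℕ) :
    ((fixedDissections n m).filter fun D =>
        IsCentral D m 0 ∧ D.card = k ∧ numCentral D m = s + 1).card
      = ((arcSets 0 m).filter fun S =>
        (breaks S 0 m).card = s ∧ (spread n d m S).card = k).card := by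
  have hm : 0 < m := by
    rcases Nat.eq_zero_or_pos m with rfl | h
    · exact absurd hn (NeZero.ne n)
    · exact h
  have h2m : 2 * m ≤ n := by rw [hn]; exact Nat.mul_le_mul_right m hd
  refine card_bij' (fun D _ => arcsIn D 0 m) (fun S _ => spread n d m S) ?_ ?_ ?_ ?_
  · intro D hD
    rw [mem_filter] at hD ⊢
    obtain ⟨h1, h2, h3, h4⟩ := hD
    rw [numCentral_eq hd hn h1 h2] at h4
    rw [spread_arcsIn hd hn h1 h2]
    exact ⟨arcsIn_mem_arcSets (mem_fixedDissections.1 h1).1 (by omega), by omega, h3⟩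
  · intro S hS
    rw [mem_filter] at hS ⊢
    have h1 := spread_mem_fixedDissections hd hn hS.1
    have h2 := isCentral_spread hd hn hS.1
    refine ⟨h1, h2, hS.2.2, ?_⟩
    rw [numCentral_eq hd hn h1 h2, arcsIn_spread hd hn hS.1, hS.2.1]
  · intro D hD
    rw [mem_filter] at hD
    exact spread_arcsIn hd hn hD.1 hD.2.1
  · intro S hS
    rw [mem_filter] at hS
    exact arcsIn_spread hd hn hS.1

open scoped Classical in
/-- The number of fixed dissections with `k` chords, by the number of vertices of the central
cell. -/
theorem card_fixedDissections (hd : 2 ≤ d) (hn : n = d * m) (k : ℕ) :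
    (((fixedDissections n m).filter fun D => D.card = k).card : ℚ)
      = ∑ s ∈ range m, (m : ℚ) / (s + 1) * ((arcSets 0 m).filter fun S =>
        (breaks S 0 m).card = s ∧ (spread n d m S).card = k).card := by
  have h1 : ((fixedDissections n m).filter fun D => D.card = k).card =
      ∑ s ∈ range m,
        ((fixedDissections n m).filter fun D => D.card = k ∧ numCentral D m = s + 1).card := by
    -- The truncated subtraction is harmless because `numCentral` is positive; `s = r - 1` is the
    -- number of breaks.
    rw [card_eq_sum_card_fiberwise (f := fun D => numCentral D m - 1) (t := range m)]
    · refine sum_congr rfl fun s _ => ?_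
      rw [filter_filter]
      refine congrArg card (filter_congr fun D hD => ?_)
      have := numCentral_pos hd hn hD
      refine and_congr_right fun _ => ?_
      omega
    · intro D hD
      have hD := (mem_filter.1 (mem_coe.1 hD)).1
      have h1 := numCentral_pos hd hn hD
      have h2 := numCentral_le (m := m) D
      rw [mem_coe, mem_range]
      dsimp only
      omega
  rw [h1]
  push_cast
  refine sum_congr rfl fun s _ => ?_
  have h2 := numCentral_mul_card (n := n) (m := m) (s + 1) k
  rw [card_central_zero hd hn] at h2
  have h3 : ((s : ℚ) + 1) ≠ 0 := by positivity
  have h4 := congrArg (Nat.cast : ℕ → ℚ) h2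
  push_cast at h4
  field_simp
  linarith

theorem card_breaks_pos_iff {S : Finset (ℤ × ℤ)} (hm : 2 ≤ m) (hS : S ∈ arcSets 0 m) :
    (breaks S 0 m).card = 0 ↔ (0, (m : ℤ)) ∈ S := by
  rw [card_eq_zero]
  exact ⟨full_mem_of_breaks_eq_empty (by omega) hS, breaks_eq_empty_of_full_mem⟩

-- Away from diameters each arc produces `d` chords, so `k` chords mean `k / d` arcs. For `d = 2` a
-- break is required because it rules out the full arc.
open scoped Classical in
theorem card_arcSets_spread (hd : 2 ≤ d) (hn : n = d * m) (s k : ℕ) (h : d = 2 → 1 ≤ s) :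
    (((arcSets 0 m).filter fun S =>
        (breaks S 0 m).card = s ∧ (spread n d m S).card = k).card : ℚ)
      = if d ∣ k then (gf 0 m s).coeff (k / d) else 0 := by
  have key : ∀ S ∈ arcSets 0 m, (breaks S 0 m).card = s → (spread n d m S).card = d * S.card := by
    intro S hS hs
    refine card_spread hd hn hS fun hd2 hmem => ?_
    have := h hd2
    rw [breaks_eq_empty_of_full_mem hmem, card_empty] at hs
    omega
  rw [gf, coeff_sum_X_pow, filter_filter]
  split_ifs with hdk
  · obtain ⟨j, rfl⟩ := hdk
    rw [Nat.mul_div_cancel_left _ (by omega)]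
    congr 2
    refine filter_congr fun S hS => and_congr_right fun hs => ?_
    rw [key S hS hs]
    exact Nat.mul_right_inj (by omega)
  · rw [Nat.cast_eq_zero, card_eq_zero, filter_eq_empty_iff]
    rintro S hS ⟨h1, h2⟩
    rw [key S hS h1] at h2
    exact hdk ⟨_, h2.symm⟩

-- The diameter case: the full arc is present and counted once instead of twice, so `k + 1` is twice
-- the number of arcs.
open scoped Classical in
theorem card_arcSets_spread_two (hn : n = 2 * m) (hm : 2 ≤ m) (k : ℕ) :
    (((arcSets 0 m).filter fun S =>
        (breaks S 0 m).card = 0 ∧ (spread n 2 m S).card = k).card : ℚ)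
      = if 2 ∣ k + 1 then (gf 0 m 0).coeff ((k + 1) / 2) else 0 := by
  have key : ∀ S ∈ arcSets 0 m, (breaks S 0 m).card = 0 →
      (spread n 2 m S).card + 1 = 2 * S.card := by
    intro S hS hs
    exact card_spread_two hn hS ((card_breaks_pos_iff hm hS).1 hs)
  rw [gf, coeff_sum_X_pow, filter_filter]
  split_ifs with hdk
  · congr 2
    refine filter_congr fun S hS => and_congr_right fun hs => ?_
    have := key S hS hs
    omega
  · rw [Nat.cast_eq_zero, card_eq_zero, filter_eq_empty_iff]
    rintro S hS ⟨h1, h2⟩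
    have := key S hS h1
    omega

end Fixed

/-! ### Arc sets with a given number of breaks as compositions -/

/-- Bivariate generating polynomial of the break-free arc sets on `[0, l]` for `1 ≤ l ≤ N`. -/
def pieceGf (N : ℕ) : ℚ[X][X] := ∑ l ∈ Icc 1 N, C (gf 0 (l : ℕ) 0) * X ^ l

theorem coeff_pieceGf (N a : ℕ) :
    (pieceGf N).coeff a = if 1 ≤ a ∧ a ≤ N then gf 0 a 0 else 0 := by
  simp only [pieceGf, finsetSum_coeff, coeff_C_mul, coeff_X_pow, mul_ite, mul_one, mul_zero,
    sum_ite_eq, mem_Icc]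

/-- `gf_succ` is a convolution with break-free pieces, so `s` breaks correspond to the power `s +
1`. The truncation at `N ≥ m` loses nothing, as no piece is longer than `m`. -/
theorem coeff_pieceGf_pow {N : ℕ} (s : ℕ) : ∀ {m : ℕ}, 1 ≤ m → m ≤ N →
    (pieceGf N ^ (s + 1)).coeff m = gf 0 m s := by
  induction s with
  | zero =>
    intro m h1 h2
    rw [zero_add, pow_one, coeff_pieceGf, if_pos ⟨h1, h2⟩]
  | succ s ih =>
    intro m h1 h2
    rw [pow_succ', coeff_mul, gf_succ, Nat.sum_antidiagonal_eq_sum_range_succ_mk]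
    symm
    refine sum_bij_ne_zero (fun z _ _ => z.toNat) ?_ ?_ ?_ ?_
    · intro z hz _
      rw [mem_Ioo] at hz
      rw [mem_range]
      omega
    · intro a ha _ b hb _ h
      rw [mem_Ioo] at ha hb
      omega
    · intro a ha hne
      rw [mem_range] at ha
      dsimp only at hne
      rw [coeff_pieceGf] at hne
      have ha1 : 1 ≤ a ∧ a ≤ N := by
        by_contra h
        rw [if_neg h, zero_mul] at hne
        exact hne rfl
      rw [if_pos ha1] at hne
      -- The remaining factor would have total length `0`, but every piece has length at least `1`.
      have ham : a ≠ m := by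
        rintro rfl
        apply hne
        rw [Nat.sub_self, pow_succ', mul_coeff_zero, coeff_pieceGf, if_neg (by omega), zero_mul,
          mul_zero]
      rw [ih (by omega) (by omega), Nat.cast_sub (by omega)] at hne
      exact ⟨(a : ℤ), mem_Ioo.2 (by omega), hne, by simp⟩
    · intro z hz _
      rw [mem_Ioo] at hz
      obtain ⟨a, rfl⟩ := Int.eq_ofNat_of_zero_le hz.1.le
      rw [Int.toNat_natCast, coeff_pieceGf, if_pos (by omega), ih (by omega) (by omega),
        Nat.cast_sub (by omega)]

theorem properGf_eq_sum {N l : ℕ} (h1 : 1 ≤ l) (h2 : l ≤ N) :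
    properGf l = ∑ c ∈ Icc 0 N, C (A ((l : ℚ) + 1) c) * X ^ c := by
  ext j
  simp only [finsetSum_coeff, coeff_C_mul, coeff_X_pow, mul_ite, mul_one, mul_zero, sum_ite_eq,
    mem_Icc]
  split_ifs with h
  · rw [A_eq_coeff h1]
  · exact coeff_properGf_eq_zero h1 (by omega) (by omega)

theorem gf_zero_eq_sum {N l : ℕ} (h1 : 1 ≤ l) (h2 : l ≤ N) :
    gf 0 l 0 = ∑ c ∈ Icc 0 N, C (A ((l : ℚ) + 1) c) * X ^ (c + if 2 ≤ l then 1 else 0) := by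
  have h : gf 0 l 0 = properGf l * X ^ (if 2 ≤ l then 1 else 0) := by
    split_ifs with h
    · rw [gf_zero_of_two_le (by omega), pow_one, mul_comm]
    · obtain rfl : l = 1 := by omega
      rw [pow_zero, mul_one]
      exact gf_one_zero.trans properGf_one.symm
  rw [h, properGf_eq_sum h1 h2, sum_mul]
  refine sum_congr rfl fun c _ => ?_
  rw [pow_add, mul_assoc]

/-- Expanding the power chooses a length and a number of inner arcs for each piece. The outer
variable records the total length, the inner one all arcs, including a full arc for each piece of
length at least two. -/
theorem pieceGf_pow (N r : ℕ) : pieceGf N ^ r =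
    ∑ p ∈ (Fintype.piFinset fun _ : Fin r => Icc 1 N) ×ˢ (Fintype.piFinset fun _ : Fin r => Icc 0 N),
      C (C (∏ i, A ((p.1 i : ℚ) + 1) (p.2 i)) *
        X ^ (∑ i, p.2 i + (univ.filter fun i => 2 ≤ p.1 i).card)) * X ^ ∑ i, p.1 i := by
  have h1 : pieceGf N = ∑ l ∈ Icc 1 N, ∑ c ∈ Icc 0 N,
      C (C (A ((l : ℚ) + 1) c) * X ^ (c + if 2 ≤ l then 1 else 0)) * (X : ℚ[X][X]) ^ l := by
    rw [pieceGf]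
    refine sum_congr rfl fun l hl => ?_
    rw [mem_Icc] at hl
    rw [gf_zero_eq_sum hl.1 hl.2, map_sum, sum_mul]
  have h2 : pieceGf N ^ r = ∏ _i : Fin r, pieceGf N := by simp
  rw [h2, h1, prod_univ_sum, sum_product]
  refine sum_congr rfl fun f _ => ?_
  rw [prod_univ_sum]
  refine sum_congr rfl fun g _ => ?_
  rw [prod_mul_distrib, prod_pow_eq_pow_sum, ← map_prod, prod_mul_distrib, prod_pow_eq_pow_sum,
    ← map_prod, sum_add_distrib, card_filter]

theorem compositionPairs_eq {n k d m j : ℕ} (hd : 1 ≤ d) (hn : n = d * m) (hk : k = d * j)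
    (hkn : k ≤ n) (r : ℕ) : compositionPairs n k d r =
      ((Fintype.piFinset fun _ : Fin r => Icc 1 n) ×ˢ
        (Fintype.piFinset fun _ : Fin r => Icc 0 n)).filter fun p => (∑ i, p.1 i) = m ∧
          (∑ i, p.2 i + (univ.filter fun i => 2 ≤ p.1 i).card) = j := by
  have hd0 : (d : ℚ) ≠ 0 := by positivity
  have e1 : (n : ℚ) / d = (m : ℕ) := by rw [hn]; push_cast; field_simp
  have e2 : (k : ℚ) / d = (j : ℕ) := by rw [hk]; push_cast; field_simp
  have hjk : j ≤ k := by rw [hk]; exact Nat.le_mul_of_pos_left _ hd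
  ext p
  rw [compositionPairs, mem_filter, mem_filter, e1, e2, Nat.cast_inj, Nat.cast_inj, mem_product,
    mem_product, Fintype.mem_piFinset, Fintype.mem_piFinset, Fintype.mem_piFinset]
  simp only [mem_Icc]
  constructor
  · rintro ⟨⟨h1, h2⟩, h3⟩
    exact ⟨⟨h1, fun i => ⟨(h2 i).1, (h2 i).2.trans hkn⟩⟩, h3⟩
  · rintro ⟨⟨h1, h2⟩, h3, h4⟩
    refine ⟨⟨h1, fun i => ⟨(h2 i).1, ?_⟩⟩, h3, h4⟩
    have := single_le_sum (f := p.2) (fun i _ => Nat.zero_le _) (mem_univ i)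
    omega

theorem compositionPairs_eq_empty {n k d : ℕ} (hd : 1 ≤ d) (hk : ¬ d ∣ k) (r : ℕ) :
    compositionPairs n k d r = ∅ := by
  have hd0 : (d : ℚ) ≠ 0 := by positivity
  rw [compositionPairs, filter_eq_empty_iff]
  rintro p - ⟨-, h⟩
  rw [eq_div_iff hd0] at h
  have h' : (∑ i, p.2 i + (univ.filter fun i => 2 ≤ p.1 i).card) * d = k := by exact_mod_cast h
  exact hk ⟨_, by rw [← h', mul_comm]⟩

theorem sum_compositionPairs {n k d m : ℕ} (hd : 1 ≤ d) (hn : n = d * m) (hm : 1 ≤ m)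
    (hkn : k ≤ n) (s : ℕ) :
    ∑ p ∈ compositionPairs n k d (s + 1), ∏ i, A ((p.1 i : ℚ) + 1) (p.2 i) =
      if d ∣ k then (gf 0 m s).coeff (k / d) else 0 := by
  split_ifs with hdk
  · obtain ⟨j, hj⟩ := hdk
    have hmn : m ≤ n := by rw [hn]; exact Nat.le_mul_of_pos_left _ hd
    rw [compositionPairs_eq hd hn hj hkn, hj, Nat.mul_div_cancel_left _ hd,
      ← coeff_pieceGf_pow s hm hmn, pieceGf_pow, sum_filter]
    simp only [finsetSum_coeff, coeff_C_mul, coeff_X_pow, mul_ite, mul_one, mul_zero]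
    refine sum_congr rfl fun p _ => ?_
    split_ifs with h1 h2 h2
    · rw [coeff_C_mul, coeff_X_pow, if_pos h1.2.symm, mul_one]
    · exact absurd h1.1.symm h2
    · rw [coeff_C_mul, coeff_X_pow, if_neg, mul_zero]
      intro h
      exact h1 ⟨h2.symm, h.symm⟩
    · rw [coeff_zero]
  · rw [compositionPairs_eq_empty hd hdk, sum_empty]

/-! ### Burnside's lemma for the rotations -/

theorem mapChords_zpow {n : ℕ} {g : Equiv.Perm (Fin n)} {D : Finset (Sym2 (Fin n))}
    (h : mapChords g D = D) (z : ℤ) : mapChords (g ^ z) D = D := by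
  induction z using Int.induction_on with
  | zero => rw [zpow_zero, mapChords_one]
  | succ i ih => rw [zpow_add_one, ← mapChords_mul, h, ih]
  | pred i ih =>
    have h' : mapChords g⁻¹ D = D := by
      nth_rewrite 1 [← h]
      rw [mapChords_mul, inv_mul_cancel, mapChords_one]
    rw [zpow_sub_one, ← mapChords_mul, h', ih]

theorem orderOf_finRotate {n : ℕ} (hn : 2 ≤ n) : orderOf (finRotate n) = n := by
  rw [(isCycle_finRotate_of_le hn).orderOf, support_finRotate_of_le hn, card_univ, Fintype.card_fin]

/-- By Bézout, the rotations by `i` and by `gcd(n, i)` are powers of each other. -/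
theorem fixedDissections_gcd {n : ℕ} (hn : 2 ≤ n) (i : ℕ) :
    fixedDissections n i = fixedDissections n (n.gcd i) := by
  ext D
  rw [mem_fixedDissections, mem_fixedDissections]
  refine and_congr_right fun _ => ⟨fun h => ?_, fun h => ?_⟩
  · have e : finRotate n ^ n.gcd i = (finRotate n ^ i) ^ n.gcdB i := by
      have h1 : finRotate n ^ n = 1 := by
        have := pow_orderOf_eq_one (finRotate n)
        rwa [orderOf_finRotate hn] at this
      rw [← zpow_natCast, Nat.gcd_eq_gcd_ab, zpow_add, zpow_mul, zpow_mul, zpow_natCast,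
        zpow_natCast, h1, one_zpow, one_mul]
    rw [e]
    exact mapChords_zpow h _
  · obtain ⟨q, hq⟩ := Nat.gcd_dvd_right n i
    have e : finRotate n ^ i = (finRotate n ^ n.gcd i) ^ (q : ℤ) := by
      rw [zpow_natCast, ← pow_mul, ← hq]
    rw [e]
    exact mapChords_zpow h _

instance (n k : ℕ) : Finite (G n k) := Subtype.finite

open scoped Classical in
theorem card_fixedBy {n k : ℕ} (i : ℕ) (g : Z n) (hg : (g : Equiv.Perm (Fin n)) = finRotate n ^ i) :
    Nat.card (MulAction.fixedBy (G n k) g) =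
      ((fixedDissections n i).filter fun D => D.card = k).card := by
  have hmem : ∀ D : G n k, D ∈ MulAction.fixedBy (G n k) g ↔
      mapChords (finRotate n ^ i) D.1 = D.1 := by
    intro D
    rw [MulAction.mem_fixedBy, ← hg]
    exact ⟨fun h => congrArg Subtype.val h, fun h => Subtype.ext h⟩
  rw [← Fintype.card_coe, ← Nat.card_eq_fintype_card]
  refine Nat.card_congr
    { toFun := fun D => ⟨D.1.1, ?_⟩
      invFun := fun D => ⟨⟨D.1, ?_⟩, ?_⟩
      left_inv := fun D => rfl
      right_inv := fun D => rfl }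
  · rw [mem_filter, mem_fixedDissections]
    exact ⟨⟨D.1.2.2, (hmem _).1 D.2⟩, D.1.2.1⟩
  · have h := D.2
    rw [mem_filter, mem_fixedDissections] at h
    exact ⟨h.2, h.1.1⟩
  · have h := D.2
    rw [mem_filter, mem_fixedDissections] at h
    exact (hmem _).2 h.1.2

-- Burnside, with the exponents `i < n` grouped by `gcd(n, i) = n / d`; there are `φ(d)` of them for
-- each `d`.
open scoped Classical in
theorem card_cyclicClasses_mul {n : ℕ} (hn : 2 ≤ n) (k : ℕ) :
    Nat.card (CyclicClasses n k) * n =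
      ∑ d ∈ n.divisors, Nat.totient d *
        ((fixedDissections n (n / d)).filter fun D => D.card = k).card := by
  have : Fintype (G n k) := Fintype.ofFinite _
  have : Fintype (CyclicClasses n k) := Fintype.ofFinite _
  have hB := MulAction.sum_card_fixedBy_eq_card_orbits_mul_card_group (Z n) (G n k)
  have hZ : Fintype.card (Z n) = n := by
    rw [Fintype.card_zpowers, orderOf_finRotate hn]
  rw [hZ] at hB
  rw [Nat.card_eq_fintype_card, ← hB]
  simp_rw [← Nat.card_eq_fintype_card]
  rw [← Equiv.sum_comp (finEquivZPowers (isOfFinOrder_of_finite (finRotate n)))]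
  have h1 : ∀ i : Fin (orderOf (finRotate n)),
      Nat.card (MulAction.fixedBy (G n k) (finEquivZPowers (isOfFinOrder_of_finite (finRotate n)) i))
        = ((fixedDissections n i).filter fun D => D.card = k).card := fun i =>
    card_fixedBy _ _ rfl
  rw [sum_congr rfl fun i _ => h1 i,
    Fin.sum_univ_eq_sum_range (fun i => ((fixedDissections n i).filter fun D => D.card = k).card),
    orderOf_finRotate hn]
  rw [sum_congr rfl fun i _ => by rw [fixedDissections_gcd hn]]
  have h2 := sum_fiberwise_of_maps_to (s := range n) (t := n.divisors) (g := fun i => n.gcd i)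
    (fun i _ => Nat.mem_divisors.2 ⟨Nat.gcd_dvd_left _ _, by omega⟩)
    (fun i => ((fixedDissections n (n.gcd i)).filter fun D => D.card = k).card)
  rw [← h2, ← Nat.sum_div_divisors]
  refine sum_congr rfl fun e he => ?_
  have hne := Nat.dvd_of_mem_divisors he
  have ht := Nat.totient_div_of_dvd (Nat.div_dvd_of_dvd hne)
  rw [Nat.div_div_self hne (by omega)] at ht
  rw [ht, ← smul_eq_mul, ← sum_const]
  refine sum_congr rfl fun i hi => ?_
  rw [(mem_filter.1 hi).2]

/-! ### Assembling the formula -/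

section Assemble

variable {n : ℕ} [NeZero n]

open scoped Classical in
/-- The number of arc sets on `[0, n / d]` with `s` breaks whose rotations by multiples of `n / d`
form a set of `k` chords. -/
def sectorCount (n d k s : ℕ) [NeZero n] : ℚ :=
  ((arcSets 0 (n / d : ℕ)).filter fun S =>
    (breaks S 0 (n / d : ℕ)).card = s ∧ (spread n d (n / d) S).card = k).card

theorem sectorCount_eq_zero {d k s : ℕ} (hd : 1 ≤ d) (hdn : d ∣ n) (hs : n / d ≤ s) :
    sectorCount n d k s = 0 := by
  classical
  rw [sectorCount, Nat.cast_eq_zero, card_eq_zero, filter_eq_empty_iff]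
  rintro S hS ⟨h, -⟩
  have h1 : (breaks S 0 (n / d : ℕ)).card ≤ (Ioo 0 ((n / d : ℕ) : ℤ)).card := card_filter_le _ _
  rw [Int.card_Ioo] at h1
  have := Nat.div_pos (Nat.le_of_dvd (NeZero.pos n) hdn) hd
  omega

theorem sectorCount_eq {d k s : ℕ} (hd : 2 ≤ d) (hdn : d ∣ n) (h : d = 2 → 1 ≤ s) :
    sectorCount n d k s = if d ∣ k then (gf 0 (n / d : ℕ) s).coeff (k / d) else 0 :=
  card_arcSets_spread hd (Nat.mul_div_cancel' hdn).symm s k h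

-- The factor `m / (s + 1)` with `m = n / d` turns into `1 / (d (s + 1))` after division by `n`.
-- Extending the sum to `range n` adds only zeros and makes the range independent of `d`.
open scoped Classical in
theorem card_fixedDissections_eq {d : ℕ} (hd : 2 ≤ d) (hdn : d ∣ n) (k : ℕ) :
    (((fixedDissections n (n / d)).filter fun D => D.card = k).card : ℚ) / n
      = ∑ s ∈ range n, 1 / (d * ((s : ℚ) + 1)) * sectorCount n d k s := by
  have hn0 : (n : ℚ) ≠ 0 := by exact_mod_cast NeZero.ne n
  have hd0 : (d : ℚ) ≠ 0 := by positivity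
  rw [card_fixedDissections hd (Nat.mul_div_cancel' hdn).symm, sum_div, Nat.cast_div hdn hd0]
  have hsub : range (n / d) ⊆ range n := range_subset_range.2 (Nat.div_le_self _ _)
  rw [← sum_subset hsub]
  · refine sum_congr rfl fun s _ => ?_
    rw [sectorCount]
    have : (s : ℚ) + 1 ≠ 0 := by positivity
    field_simp
  · intro s _ hs
    rw [mem_range, not_lt] at hs
    rw [sectorCount_eq_zero (by omega) hdn hs, mul_zero]

/-- Fixed dissections whose central cell has one vertex modulo the rotation. -/
theorem sectorCount_zero {d k : ℕ} (hd : 3 ≤ d) (hdn : d ∣ n) (hk : 1 ≤ k) (hkn : k < n) :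
    sectorCount n d k 0 = A ((n : ℚ) / d + 1) ((k : ℚ) / d - 1) := by
  have hd0 : (d : ℚ) ≠ 0 := by positivity
  rw [sectorCount_eq (by omega) hdn (by omega)]
  split_ifs with hdk
  · obtain ⟨j, rfl⟩ := hdk
    obtain ⟨m, hm⟩ := hdn
    have hj : 1 ≤ j := Nat.pos_of_mul_pos_left hk
    have hjm : j < m := by rw [hm] at hkn; exact Nat.lt_of_mul_lt_mul_left hkn
    have e1 : (n : ℚ) / d = m := by rw [hm]; push_cast; field_simp
    have e2 : ((d * j : ℕ) : ℚ) / d - 1 = (j - 1 : ℕ) := by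
      rw [Nat.cast_sub hj]; push_cast; field_simp
    rw [e1, e2, A_eq_coeff (by omega), hm, Nat.mul_div_cancel_left _ (by omega),
      Nat.mul_div_cancel_left _ (by omega), gf_zero_of_two_le (by omega)]
    obtain ⟨i, rfl⟩ : ∃ i, j = i + 1 := ⟨j - 1, by omega⟩
    rw [coeff_X_mul, Nat.add_sub_cancel]
  · symm
    by_contra hne
    obtain ⟨p, j, -, -, h2⟩ := exists_of_A_ne_zero hne
    have h3 : (k : ℚ) = d * (j + 1) := by
      field_simp at h2; linarith
    exact hdk ⟨j + 1, by exact_mod_cast h3⟩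

/-- Here the central cell is a diameter. There are `(k + 1) / 2` arcs, one of them the full arc,
which leaves `(k - 1) / 2`. -/
theorem sectorCount_two_zero {k : ℕ} (hn : 3 ≤ n) (hdn : 2 ∣ n) :
    sectorCount n 2 k 0 = A ((n : ℚ) / 2 + 1) (((k : ℚ) - 1) / 2) := by
  obtain ⟨m, hm⟩ := hdn
  have hm2 : n / 2 = m := by omega
  have h := card_arcSets_spread_two hm (by omega) k
  rw [sectorCount, hm2, h]
  split_ifs with hdk
  · obtain ⟨j, hj⟩ := hdk
    obtain ⟨i, rfl⟩ : ∃ i, j = i + 1 := ⟨j - 1, by omega⟩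
    have e1 : (n : ℚ) / 2 = m := by rw [hm]; push_cast; field_simp
    have e2 : ((k : ℚ) - 1) / 2 = i := by
      have : (k : ℚ) + 1 = 2 * (i + 1) := by exact_mod_cast hj
      linarith
    rw [e1, e2, A_eq_coeff (by omega), hj, Nat.mul_div_cancel_left _ (by omega),
      gf_zero_of_two_le (by omega), coeff_X_mul]
  · symm
    by_contra hne
    obtain ⟨p, j, -, -, h2⟩ := exists_of_A_ne_zero hne
    have h3 : (k : ℚ) + 1 = 2 * (j + 1) := by linarith
    exact hdk ⟨j + 1, by exact_mod_cast h3⟩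

/-- Fixed dissections whose central cell has two vertices modulo the rotation. -/
theorem sectorCount_one {d k : ℕ} (hd : 2 ≤ d) (hdn : d ∣ n) (hd3 : d ≤ n / 3) (hk : 1 ≤ k) :
    (n : ℚ) * sectorCount n d k 1 = 2 * ((n : ℚ) + k - d) * A ((n : ℚ) / d) ((k : ℚ) / d - 1) := by
  have hd0 : (d : ℚ) ≠ 0 := by positivity
  rw [sectorCount_eq hd hdn (fun _ => le_rfl)]
  split_ifs with hdk
  · obtain ⟨j, rfl⟩ := hdk
    obtain ⟨m, hm⟩ := hdn
    have hj : 1 ≤ j := Nat.pos_of_mul_pos_left hk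
    have hm3 : 3 ≤ m := by
      by_contra hcon
      have : d * m ≤ d * 2 := Nat.mul_le_mul_left d (by omega)
      omega
    obtain ⟨i, rfl⟩ : ∃ i, j = i + 1 := ⟨j - 1, by omega⟩
    have e1 : (n : ℚ) / d = (m - 1 : ℕ) + 1 := by
      rw [hm, Nat.cast_sub (by omega)]; push_cast; field_simp; ring
    have e2 : ((d * (i + 1) : ℕ) : ℚ) / d - 1 = i := by push_cast; field_simp; ring
    -- With `k = d (i + 1)` and `n = d m`, the factor `m + i` of `coeff_gf_one` becomes `(n + k - d)
    -- / d`.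
    have : NeZero m := ⟨by omega⟩
    have h := coeff_gf_one (n := m) hm3 i
    rw [e1, e2, A_eq_coeff (by omega), Nat.mul_div_cancel_left _ (by omega)]
    have e3 : n / d = m := by rw [hm, Nat.mul_div_cancel_left _ (by omega)]
    have e4 : (((m - 1 : ℕ) : ℕ) : ℤ) = m - 1 := by omega
    rw [e3, e4]
    have e5 : (n : ℚ) = d * m := by rw [hm]; push_cast; rfl
    rw [e5, mul_assoc, h]
    push_cast
    ring
  · rw [mul_zero]
    symm
    rw [mul_eq_zero]
    right
    by_contra hne
    obtain ⟨p, j, -, -, h2⟩ := exists_of_A_ne_zero hne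
    have h3 : (k : ℚ) = d * (j + 1) := by
      field_simp at h2; linarith
    exact hdk ⟨j + 1, by exact_mod_cast h3⟩

/-- The sector has length at most `2`, where a break leaves room only for the empty arc set, whereas
`k ≥ 1`. -/
theorem sectorCount_one_eq_zero {d k : ℕ} (hd : 2 ≤ d) (hdn : d ∣ n) (hd3 : n / 3 < d)
    (hk : 1 ≤ k) : sectorCount n d k 1 = 0 := by
  rw [sectorCount_eq hd hdn (fun _ => le_rfl)]
  split_ifs with hdk
  · obtain ⟨j, rfl⟩ := hdk
    obtain ⟨m, hm⟩ := hdn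
    have hj : 1 ≤ j := Nat.pos_of_mul_pos_left hk
    have hm3 : m < 3 := by
      by_contra hcon
      have : d * 3 ≤ d * m := Nat.mul_le_mul_left d (by omega)
      omega
    rw [hm, Nat.mul_div_cancel_left _ (by omega), Nat.mul_div_cancel_left _ (by omega), gf_succ]
    interval_cases m
    · simp
    · have : Ioo (0 : ℤ) ((1 : ℕ) : ℤ) = ∅ := by rfl
      rw [this, sum_empty, coeff_zero]
    · have : Ioo (0 : ℤ) ((2 : ℕ) : ℤ) = {1} := by rfl
      rw [this, sum_singleton]
      have : (((2 : ℕ) : ℤ) - 1) = 1 := by norm_num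
      rw [this, gf_one_zero, mul_one, coeff_one, if_neg (by omega)]
  · rfl

/-- The two index sets agree on nonzero terms: divisors above `n / 3` contribute nothing on the
left, and non-divisors give a fractional argument of `A` on the right. -/
theorem sum_sectorCount_one {k : ℕ} (hk : 1 ≤ k) :
    ∑ d ∈ n.divisors with 2 ≤ d, (Nat.totient d : ℚ) * (1 / (d * 2) * sectorCount n d k 1) =
      ∑ d ∈ Icc 2 (n / 3), (Nat.totient d : ℚ) * ((n : ℚ) + k - d) / (d * n) *
        A ((n : ℚ) / d) ((k : ℚ) / d - 1) := by
  have hn0 : (n : ℚ) ≠ 0 := by exact_mod_cast NeZero.ne n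
  refine sum_bij_ne_zero (fun d _ _ => d) ?_ (fun _ _ _ _ _ _ h => h) ?_ ?_
  · intro d hd hne
    rw [mem_filter, Nat.mem_divisors] at hd
    rw [mem_Icc]
    refine ⟨hd.2, ?_⟩
    by_contra hcon
    rw [sectorCount_one_eq_zero hd.2 hd.1.1 (by omega) hk, mul_zero, mul_zero] at hne
    exact hne rfl
  · intro d hd hne
    rw [mem_Icc] at hd
    have hd0 : (d : ℚ) ≠ 0 := by
      have : d ≠ 0 := by omega
      exact_mod_cast this
    have hdn : d ∣ n := by
      obtain ⟨p, j, -, h1, -⟩ := exists_of_A_ne_zero (right_ne_zero_of_mul hne)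
      rw [div_eq_iff hd0] at h1
      exact ⟨p + 1, by rw [mul_comm]; exact_mod_cast h1⟩
    refine ⟨d, mem_filter.2 ⟨Nat.mem_divisors.2 ⟨hdn, NeZero.ne n⟩, hd.1⟩, ?_, rfl⟩
    have h := sectorCount_one hd.1 hdn hd.2 hk
    intro h0
    have ht : (Nat.totient d : ℚ) ≠ 0 := by
      have := Nat.totient_pos.2 (show 0 < d by omega)
      exact_mod_cast this.ne'
    have h1 : sectorCount n d k 1 = 0 := by
      rcases mul_eq_zero.1 h0 with h0 | h0
      · exact absurd h0 ht
      · rcases mul_eq_zero.1 h0 with h0 | h0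
        · exact absurd h0 (by positivity)
        · exact h0
    rw [h1, mul_zero] at h
    apply hne
    have h2 : ((n : ℚ) + k - d) * A ((n : ℚ) / d) ((k : ℚ) / d - 1) = 0 := by linarith
    rw [mul_div_right_comm, mul_assoc, h2, mul_zero]
  · intro d hd hne
    rw [mem_filter, Nat.mem_divisors] at hd
    have hd0 : (d : ℚ) ≠ 0 := by
      have : d ≠ 0 := by omega
      exact_mod_cast this
    have hd3 : d ≤ n / 3 := by
      by_contra hcon
      rw [sectorCount_one_eq_zero hd.2 hd.1.1 (by omega) hk, mul_zero, mul_zero] at hne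
      exact hne rfl
    have h := sectorCount_one hd.2 hd.1.1 hd3 hk
    have h' : sectorCount n d k 1 = 2 * ((n : ℚ) + k - d) * A ((n : ℚ) / d) ((k : ℚ) / d - 1) / n := by
      rw [← h]; field_simp
    rw [h']
    field_simp

/-- The divisor `2` is split off because of diameters; for odd `n` its term is already zero, since
`n / 2` is not an integer. -/
theorem sum_sectorCount_zero {k : ℕ} (hn : 3 ≤ n) (hk : 1 ≤ k) (hkn : k < n) :
    ∑ d ∈ n.divisors with 2 ≤ d, (Nat.totient d : ℚ) * (1 / d * sectorCount n d k 0) =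
      1 / 2 * A ((n : ℚ) / 2 + 1) (((k : ℚ) - 1) / 2)
      + ∑ d ∈ n.divisors with 3 ≤ d,
          (Nat.totient d : ℚ) / d * A ((n : ℚ) / d + 1) ((k : ℚ) / d - 1) := by
  have h3 : ∑ d ∈ n.divisors with 3 ≤ d, (Nat.totient d : ℚ) * (1 / d * sectorCount n d k 0) =
      ∑ d ∈ n.divisors with 3 ≤ d,
          (Nat.totient d : ℚ) / d * A ((n : ℚ) / d + 1) ((k : ℚ) / d - 1) := by
    refine sum_congr rfl fun d hd => ?_
    rw [mem_filter, Nat.mem_divisors] at hd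
    rw [sectorCount_zero hd.2 hd.1.1 hk hkn]
    ring
  rw [← h3]
  by_cases h2 : 2 ∣ n
  · have hI : n.divisors.filter (fun d => 2 ≤ d) =
        insert 2 (n.divisors.filter fun d => 3 ≤ d) := by
      ext d
      rw [mem_insert, mem_filter, mem_filter, Nat.mem_divisors]
      constructor
      · rintro ⟨h4, h5⟩
        rcases h5.eq_or_lt with h | h
        · exact Or.inl h.symm
        · exact Or.inr ⟨h4, h⟩
      · rintro (rfl | ⟨h4, h5⟩)
        · exact ⟨⟨h2, NeZero.ne n⟩, le_rfl⟩
        · exact ⟨h4, by omega⟩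
    rw [hI, sum_insert (by simp), sectorCount_two_zero hn h2]
    simp
  · have hA : A ((n : ℚ) / 2 + 1) (((k : ℚ) - 1) / 2) = 0 := by
      by_contra hne
      obtain ⟨p, j, -, h4, -⟩ := exists_of_A_ne_zero hne
      have h5 : (n : ℚ) = 2 * p := by linarith
      exact h2 ⟨p, by exact_mod_cast h5⟩
    rw [hA, mul_zero, zero_add]
    refine sum_congr (filter_congr fun d hd => ?_) fun _ _ => rfl
    rw [Nat.mem_divisors] at hd
    constructor
    · intro h4
      rcases h4.eq_or_lt with h | h
      · exact absurd (h ▸ hd.1) h2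
      · exact h
    · intro h4; omega

theorem sum_sectorCount_composition {d k : ℕ} (hd : 2 ≤ d) (hdn : d ∣ n) (hkn : k ≤ n) :
    ∑ s ∈ Ico 2 n, 1 / (d * ((s : ℚ) + 1)) * sectorCount n d k s =
      ∑ r ∈ Icc 3 n, ∑ p ∈ compositionPairs n k d r,
        1 / ((d : ℚ) * r) * ∏ i, A ((p.1 i : ℚ) + 1) (p.2 i) := by
  refine sum_bij (fun s _ => s + 1) ?_ ?_ ?_ ?_
  · intro s hs
    rw [mem_Ico] at hs
    rw [mem_Icc]
    omega
  · intro a _ b _ h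
    omega
  · intro r hr
    rw [mem_Icc] at hr
    exact ⟨r - 1, mem_Ico.2 (by omega), by omega⟩
  · intro s hs
    rw [mem_Ico] at hs
    rw [← mul_sum, sum_compositionPairs (by omega) (Nat.mul_div_cancel' hdn).symm
      (Nat.div_pos (Nat.le_of_dvd (NeZero.pos n) hdn) (by omega)) hkn,
      sectorCount_eq hd hdn (by omega)]
    push_cast
    rfl

end Assemble

end PolygonDissection

end

/-! ### The Burnside average, split by the size of the central cell -/

theorem theorem7 (n k : ℕ) (hn : 3 ≤ n) (hk : 1 ≤ k) (hkn : k ≤ n - 3) :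
    (Nat.card (PolygonDissection.CyclicClasses n k) : ℚ) =
      1 / (n : ℚ) * PolygonDissection.A n k
      + 1 / 2 * PolygonDissection.A ((n : ℚ) / 2 + 1) (((k : ℚ) - 1) / 2)
      + ∑ d ∈ n.divisors with 3 ≤ d,
          (Nat.totient d : ℚ) / d * PolygonDissection.A ((n : ℚ) / d + 1) ((k : ℚ) / d - 1)
      + ∑ d ∈ Finset.Icc 2 (n / 3),
          (Nat.totient d : ℚ) * ((n : ℚ) + k - d) / (d * n) *
            PolygonDissection.A ((n : ℚ) / d) ((k : ℚ) / d - 1)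
      + ∑ d ∈ n.divisors with 2 ≤ d, ∑ r ∈ Finset.Icc 3 n,
          ∑ p ∈ PolygonDissection.compositionPairs n k d r,
            (Nat.totient d : ℚ) / (d * r) *
              ∏ i, PolygonDissection.A ((p.1 i : ℚ) + 1) (p.2 i) := by
  classical
  have : NeZero n := ⟨by omega⟩
  have hn0 : (n : ℚ) ≠ 0 := by exact_mod_cast NeZero.ne n
  have hB := congrArg (Nat.cast : ℕ → ℚ) (PolygonDissection.card_cyclicClasses_mul
    (n := n) (by omega) k)
  push_cast at hB
  -- The divisor `d = 1` is the identity rotation, which fixes every dissection and has no sector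
  -- decomposition.
  have h1 : ((((PolygonDissection.fixedDissections n (n / 1)).filter
      fun D => D.card = k).card : ℕ) : ℚ) = PolygonDissection.A n k := by
    have e1 : (n : ℚ) = ((n - 1 : ℕ) : ℚ) + 1 := by rw [Nat.cast_sub (by omega)]; simp
    have e2 : PolygonDissection.fixedDissections n (n / 1) = PolygonDissection.dissections n := by
      ext D
      have e3 : finRotate n ^ n = 1 := by
        have := pow_orderOf_eq_one (finRotate n)
        rwa [PolygonDissection.orderOf_finRotate (by omega)] at this
      rw [PolygonDissection.mem_fixedDissections, PolygonDissection.mem_dissections, Nat.div_one,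
        e3, PolygonDissection.mapChords_one]
      simp
    rw [e1, PolygonDissection.A_eq_coeff (by omega), e2, ← PolygonDissection.coeff_sum_X_pow,
      PolygonDissection.sum_dissections (by omega), Nat.cast_sub (by omega), Nat.cast_one]
  have hdiv : n.divisors = insert 1 (n.divisors.filter fun d => 2 ≤ d) := by
    ext d
    rw [Finset.mem_insert, Finset.mem_filter]
    constructor
    · intro hd
      have := Nat.pos_of_mem_divisors hd
      by_cases h : d = 1
      · exact Or.inl h
      · exact Or.inr ⟨hd, by omega⟩
    · rintro (rfl | h)
      · exact Nat.one_mem_divisors.2 (NeZero.ne n)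
      · exact h.1
  have hC : (Nat.card (PolygonDissection.CyclicClasses n k) : ℚ) =
      1 / (n : ℚ) * PolygonDissection.A n k + ∑ d ∈ n.divisors with 2 ≤ d, (Nat.totient d : ℚ) *
        (∑ s ∈ Finset.range n, 1 / (d * ((s : ℚ) + 1)) *
          PolygonDissection.sectorCount n d k s) := by
    rw [← mul_div_cancel_right₀ (Nat.card (PolygonDissection.CyclicClasses n k) : ℚ) hn0, hB]
    nth_rewrite 1 [hdiv]
    rw [Finset.sum_insert (by simp), add_div, h1, Nat.totient_one, Finset.sum_div]
    congr 1
    · rw [Nat.cast_one]; ring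
    · refine Finset.sum_congr rfl fun d hd => ?_
      rw [Finset.mem_filter, Nat.mem_divisors] at hd
      rw [← PolygonDissection.card_fixedDissections_eq hd.2 hd.1.1, mul_div_assoc]
  have hsplit : ∀ d ∈ n.divisors.filter (fun d => 2 ≤ d), (Nat.totient d : ℚ) *
        (∑ s ∈ Finset.range n, 1 / (d * ((s : ℚ) + 1)) *
          PolygonDissection.sectorCount n d k s) =
      (Nat.totient d : ℚ) * (1 / d * PolygonDissection.sectorCount n d k 0) +
      (Nat.totient d : ℚ) * (1 / (d * 2) * PolygonDissection.sectorCount n d k 1) +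
      ∑ r ∈ Finset.Icc 3 n, ∑ p ∈ PolygonDissection.compositionPairs n k d r,
            (Nat.totient d : ℚ) / (d * r) *
              ∏ i, PolygonDissection.A ((p.1 i : ℚ) + 1) (p.2 i) := by
    intro d hd
    rw [Finset.mem_filter, Nat.mem_divisors] at hd
    have h := PolygonDissection.sum_sectorCount_composition hd.2 hd.1.1 (k := k) (by omega)
    have hr : ∑ r ∈ Finset.Icc 3 n, ∑ p ∈ PolygonDissection.compositionPairs n k d r,
            (Nat.totient d : ℚ) / (d * r) *
              ∏ i, PolygonDissection.A ((p.1 i : ℚ) + 1) (p.2 i) =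
        (Nat.totient d : ℚ) * ∑ s ∈ Finset.Ico 2 n, 1 / (d * ((s : ℚ) + 1)) *
          PolygonDissection.sectorCount n d k s := by
      rw [h, Finset.mul_sum]
      refine Finset.sum_congr rfl fun r _ => ?_
      rw [Finset.mul_sum]
      refine Finset.sum_congr rfl fun p _ => ?_
      rw [← mul_assoc, mul_one_div]
    -- Peel off `s = 0` and `s = 1`, that is `r = 1` and `r = 2`; the rest is the composition sum
    -- with `r = s + 1 ≥ 3`.
    rw [hr, Finset.range_eq_Ico, Finset.sum_eq_sum_Ico_succ_bot (by omega),
      Finset.sum_eq_sum_Ico_succ_bot (by omega), zero_add, one_add_one_eq_two]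
    generalize ∑ s ∈ Finset.Ico 2 n, 1 / ((d : ℚ) * ((s : ℚ) + 1)) *
          PolygonDissection.sectorCount n d k s = T
    push_cast
    ring
  rw [hC, Finset.sum_congr rfl hsplit, Finset.sum_add_distrib, Finset.sum_add_distrib,
    PolygonDissection.sum_sectorCount_zero hn hk (by omega),
    PolygonDissection.sum_sectorCount_one hk]
  ring
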